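/- Let $q$ be a prime power. A probability measure $\mu$ on $\mathbf F_q$ is called $\alpha$-balanced if $\mu(x+H)\le 1-\alpha$ for every $x\in\mathbf F_q$ and every proper additive subgroup $H<\mathbf F_q$. For $n\ge 0$ let $\boldsymbol\mu=(\mu_{ij})_{1\le i,j\le n}$ be a matrix of $\alpha$-balanced probability measures on $\mathbf F_q$, and let $M$ be a random $n\times n$ matrix over $\mathbf F_q$ with independent entries $M_{ij}\sim\mu_{ij}$; write $X_i\sim\mu_{i1}\otimes\cdots\otimes\mu_{in}$ for its $i$-th row and $\operatorname{row}M_k=\langle X_1,\dots,X_k\rangle$ for the row space of its top $k\times n$ submatrix $M_k$. For a subspace $V\le\mathbf F_q^n$ put \[ \rho(V)=\max_{1\le i\le n}\ \max_{x\in\mathbf F_q^n}\left|\mathbf P(X_i\in x+V)-q^{-\operatorname{codim}V}\right| \] (with $\rho(V)=0$ if $n=0$). Given $\delta,\zeta>0$, call $V$ sparse if there is a nonzero $v\in\mathbf F_q^n$ with $v\perp V$ (for the standard bilinear form) having at most $\delta n$ nonzero coordinates, and call $V$ saturated if $V$ is not sparse and $\rho(V)\le e^{-\zeta\alpha n}$.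 **Theorem.** Let $\eta>0$ be a sufficiently small absolute constant, let $\delta>0$ be sufficiently small depending on $\eta$, and let $\zeta>0$ be sufficiently small depending on $\eta,\delta$. Then there is a constant $c>0$ depending only on $\eta,\delta,\zeta$, and for every $\alpha>0$ a constant $C_\alpha>0$ depending only on $\eta,\delta,\zeta,\alpha$, such that for all prime powers $q$, all $n$, all $\boldsymbol\mu$ as above and all integers $k$ with $(1-\eta)n\le k\le n$, \[ \left|\mathbf P(\operatorname{row}M_k\text{ is saturated})-1\right|\le C_\alpha e^{-c\alpha n}. \] -/

import Mathlib

open MeasureTheory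

noncomputable section

/-- A measure `μ` on the additive group of `F` is `α`-balanced if every coset of every proper
additive subgroup has mass at most `1 - α`. -/
def IsBalanced {F : Type*} [Field F] [MeasurableSpace F] (α : ℝ) (μ : Measure F) : Prop :=
  ∀ H : AddSubgroup F, H ≠ ⊤ → ∀ x : F, μ.real {y | y - x ∈ H} ≤ 1 - α

/-- The law of the `i`-th row, `μ i 1 ⊗ ⋯ ⊗ μ i n`. -/
def rowLaw {F : Type*} [MeasurableSpace F] {n : ℕ} (μ : Fin n → Fin n → Measure F) (i : Fin n) :
    Measure (Fin n → F) :=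
  Measure.pi (μ i)

/-- The law of the family of entries of a random `n × n` matrix with independent entries, the entry
at `(i, j)` having law `μ i j`. -/
def matrixLaw {F : Type*} [MeasurableSpace F] {n : ℕ} (μ : Fin n → Fin n → Measure F) :
    Measure (Fin n → Fin n → F) :=
  Measure.pi fun i => rowLaw μ i

/-- The row space of the top `k × n` submatrix of `M`. -/
def topRowSpace {F : Type*} [Field F] {n k : ℕ} (hk : k ≤ n) (M : Matrix (Fin n) (Fin n) F) :
    Submodule F (Fin n → F) :=
  Submodule.span F (Set.range (M.submatrix (Fin.castLE hk) id).row)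

/-- The codimension of a subspace of `F ^ n`. -/
def codim {F : Type*} [Field F] {n : ℕ} (V : Submodule F (Fin n → F)) : ℕ :=
  Module.finrank F ((Fin n → F) ⧸ V)

/-- The nonuniformity of the `i`-th row modulo `V` (for finite `F`, a maximum over a finite
nonempty set). -/
def rowNonuniformity {F : Type*} [Field F] [MeasurableSpace F] {n : ℕ}
    (μ : Fin n → Fin n → Measure F) (i : Fin n) (V : Submodule F (Fin n → F)) : ℝ :=
  ⨆ x : Fin n → F, |(rowLaw μ i).real {y | y - x ∈ V} - 1 / (Nat.card F : ℝ) ^ codim V|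

/-- The maximum over all `n` rows of the nonuniformity modulo `V` (`0` if `n = 0`). -/
def nonuniformity {F : Type*} [Field F] [MeasurableSpace F] {n : ℕ}
    (μ : Fin n → Fin n → Measure F) (V : Submodule F (Fin n → F)) : ℝ :=
  ⨆ i : Fin n, rowNonuniformity μ i V

/-- `V` is sparse (with parameter `δ`) if some nonzero vector orthogonal to `V` has at most `δ n`
nonzero coordinates. -/
def IsSparse {F : Type*} [Field F] {n : ℕ} (δ : ℝ) (V : Submodule F (Fin n → F)) : Prop :=
  ∃ v : Fin n → F, v ≠ 0 ∧ (∀ w ∈ V, v ⬝ᵥ w = 0) ∧ ((Function.support v).ncard : ℝ) ≤ δ * n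

/-- `V` is saturated with respect to `μ` (with parameters `δ`, `ζ`, `α`). -/
def IsSaturated {F : Type*} [Field F] [MeasurableSpace F] {n : ℕ} (δ ζ α : ℝ)
    (μ : Fin n → Fin n → Measure F) (V : Submodule F (Fin n → F)) : Prop :=
  ¬ IsSparse δ V ∧ nonuniformity μ V ≤ Real.exp (-(ζ * α * n))

end

/-! Let `V` be the row space of the top `k` rows, `d` its codimension, `q` the order of the field
and `R` the nonuniformity. There are three ways to fail to be saturated, and each is exponentially
unlikely.

Sparse `V` (`pr_isSparse_le`). A vector `v` of minimal support `S` orthogonal to all rows is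
determined up to a scalar by fewer than `#S` of them (`exists_support_of_isSparse`). Once `S` and
these rows are fixed, at least `0.89 n` further independent rows must be orthogonal to `v`. Each is
so with probability at most `1 - α`, and at most `7/10` when `α * #S ≥ 10`. There is no union over
the values of `v`, so the bound does not depend on `q`.

The other two cases are Fourier analytic. Up to the factor `q ^ (-d)`, the nonuniformity of a row is
at most the sum of `exp (-f / 2)` over the nonzero vectors orthogonal to `V`, where `f` is
`rowDefect`, the square of a seminorm.

Unsaturated `V`, not sparse, with `R V > q ^ (-d) / 5` (`pr_unsaturated_le`). Every nontrivial group
of vectors orthogonal to `V` contains one with `f > α δ n`, so level sets of `f` grow linearly in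
the radius (`IsSqNorm.card_level_le`). A Halász argument then bounds `R V` by a small constant times
the probability that a lazy symmetrized row lies in `V` (`abs_pr_coset_sub_le_lazy`); the true rows
therefore hit `V` much less often than lazy ones. Swapping `⌊δ n⌋` rows for lazy samples, in the
manner of Kahn, Komlós and Szemerédi, gains a power of that constant that beats the `2 ^ k` choices
of swapped rows (`pr_span_mem_le_of_swap`).

Semi-saturated `V`, with `exp (-ζ α n) < R V ≤ q ^ (-d) / 5` (`pr_semisaturated_le`). Here `q ^ d`
is at most `exp (ζ α n)`, each row lies in `V` with probability at most `(6/5) q ^ (-d)`, and some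
nonzero vector orthogonal to `V` has `f ≤ 2 ζ α n` for some row. Only about a proportion `(7/10) ^
n` of all vectors are like that (`card_rowDefect_le`), and counting the possible `V` finishes
because `7/10 * 6/5 < 1`. -/

/-! ### Finite probability weights, products and conditioning. -/

section Weights

open Finset
open scoped Classical

/-- A probability weight function on a finite type. -/
structure IsWeight {Ω : Type*} [Fintype Ω] (p : Ω → ℝ) : Prop where
  nonneg : ∀ x, 0 ≤ p x
  sum_eq_one : ∑ x, p x = 1

/-- The mass of a set under a weight function. -/
noncomputable def pr {Ω : Type*} [Fintype Ω] (p : Ω → ℝ) (S : Set Ω) : ℝ :=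
  ∑ x with x ∈ S, p x

/-- The product of a family of weight functions. -/
def pw {ι Ω : Type*} [Fintype ι] (p : ι → Ω → ℝ) : (ι → Ω) → ℝ :=
  fun X => ∏ i, p i (X i)

variable {Ω ι κ : Type*} [Fintype Ω] [Fintype ι] [Fintype κ]
  [DecidableEq ι] [DecidableEq κ]

lemma pr_eq_sum_ite (p : Ω → ℝ) (S : Set Ω) : pr p S = ∑ x, if x ∈ S then p x else 0 := by
  rw [pr, Finset.sum_filter]

lemma pr_nonneg {p : Ω → ℝ} (hp : ∀ x, 0 ≤ p x) (S : Set Ω) : 0 ≤ pr p S :=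
  Finset.sum_nonneg fun x _ => hp x

lemma pr_mono {p : Ω → ℝ} (hp : ∀ x, 0 ≤ p x) {S T : Set Ω} (h : S ⊆ T) : pr p S ≤ pr p T := by
  apply Finset.sum_le_sum_of_subset_of_nonneg
  · intro x hx
    simp only [Finset.mem_filter, Finset.mem_univ, true_and] at hx ⊢
    exact h hx
  · intro x _ _
    exact hp x

lemma pr_univ (p : Ω → ℝ) : pr p Set.univ = ∑ x, p x := by
  simp [pr]

lemma IsWeight.pr_le_one {p : Ω → ℝ} (hp : IsWeight p) (S : Set Ω) : pr p S ≤ 1 := by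
  rw [← hp.sum_eq_one, ← pr_univ]
  exact pr_mono hp.nonneg (Set.subset_univ S)

lemma pr_le_sum_pr {β : Type*} {p : Ω → ℝ} (hp : ∀ x, 0 ≤ p x) (t : Finset β) {S : Set Ω}
    (E : β → Set Ω) (h : ∀ x ∈ S, ∃ b ∈ t, x ∈ E b) : pr p S ≤ ∑ b ∈ t, pr p (E b) := by
  simp only [pr_eq_sum_ite]
  rw [Finset.sum_comm]
  apply Finset.sum_le_sum
  intro x _
  have h0 : ∀ b ∈ t, 0 ≤ (if x ∈ E b then p x else 0) := fun b _ => by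
    split_ifs
    · exact hp x
    · exact le_rfl
  by_cases hx : x ∈ S
  · obtain ⟨b, hb, hxb⟩ := h x hx
    calc (if x ∈ S then p x else 0) = (if x ∈ E b then p x else 0) := by simp [hx, hxb]
      _ ≤ _ := Finset.single_le_sum h0 hb
  · simp only [hx, if_false]
    exact Finset.sum_nonneg h0

lemma pr_union_le {p : Ω → ℝ} (hp : ∀ x, 0 ≤ p x) (S T : Set Ω) :
    pr p (S ∪ T) ≤ pr p S + pr p T := by
  have := pr_le_sum_pr hp (Finset.univ : Finset Bool) (S := S ∪ T) (fun b => if b then S else T)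
    (by
      rintro x (hx | hx)
      · exact ⟨true, by simp, by simpa using hx⟩
      · exact ⟨false, by simp, by simpa using hx⟩)
  simpa using this

/-- Disjoint events have total mass at most one. -/
lemma IsWeight.sum_pr_fiber_le_one {β : Type*} {p : Ω → ℝ} (hp : IsWeight p) (t : Finset β)
    (f : Ω → β) : ∑ b ∈ t, pr p {x | f x = b} ≤ 1 := by
  simp only [pr_eq_sum_ite]
  rw [Finset.sum_comm, ← hp.sum_eq_one]
  apply Finset.sum_le_sum
  intro x _
  simp only [Set.mem_ofPred_eq, Finset.sum_ite_eq]
  split_ifs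
  · exact le_rfl
  · exact hp.nonneg x

omit [Fintype Ω] [DecidableEq ι] in
lemma pw_nonneg {p : ι → Ω → ℝ} (hp : ∀ i x, 0 ≤ p i x) (X : ι → Ω) : 0 ≤ pw p X :=
  Finset.prod_nonneg fun i _ => hp i (X i)

lemma pr_pw_box (p : ι → Ω → ℝ) (T : ι → Set Ω) :
    pr (pw p) {X | ∀ i, X i ∈ T i} = ∏ i, pr (p i) (T i) := by
  unfold pr pw
  rw [Finset.prod_univ_sum]
  apply Finset.sum_congr _ fun _ _ => rfl
  ext X
  simp [Fintype.mem_piFinset]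

lemma IsWeight.pw {p : ι → Ω → ℝ} (hp : ∀ i, IsWeight (p i)) : IsWeight (pw p) where
  nonneg := pw_nonneg fun i => (hp i).nonneg
  sum_eq_one := by
    have := pr_pw_box p (fun _ => Set.univ)
    simp only [Set.mem_univ, implies_true, Set.ofPred_true, pr_univ, (hp _).sum_eq_one,
      Finset.prod_const_one] at this
    exact this

lemma pr_eq_sum_pr_and (p : Ω → ℝ) {β : Type*} [Fintype β] (f : Ω → β) (S : Set Ω) :
    pr p S = ∑ b, pr p {x | f x = b ∧ x ∈ S} := by
  simp only [pr_eq_sum_ite]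
  rw [Finset.sum_comm]
  apply Finset.sum_congr rfl
  intro x _
  by_cases hx : x ∈ S <;> simp [hx]

/-- The marginal of a product weight along an injection of index types. -/
lemma pr_pw_comp {p : ι → Ω → ℝ} (hp : ∀ i, IsWeight (p i)) (e : κ → ι)
    (he : Function.Injective e) (E : Set (κ → Ω)) :
    pr (pw p) {X | X ∘ e ∈ E} = pr (pw (p ∘ e)) E := by
  rw [pr_eq_sum_pr_and (pw p) (fun X => X ∘ e), pr_eq_sum_ite]
  apply Finset.sum_congr rfl
  intro Z _
  by_cases hZ : Z ∈ E
  · have : {X : ι → Ω | X ∘ e = Z ∧ X ∈ {X | X ∘ e ∈ E}}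
        = {X | ∀ i, X i ∈ {y | ∀ k, e k = i → y = Z k}} := by
      ext X
      simp only [Set.mem_ofPred_eq]
      constructor
      · rintro ⟨rfl, -⟩ i k rfl
        rfl
      · intro h
        have : X ∘ e = Z := funext fun k => h (e k) k rfl
        exact ⟨this, this ▸ hZ⟩
    rw [this, pr_pw_box, if_pos hZ, pw]
    symm
    apply Fintype.prod_of_injective e he
    · intro i hi
      have : {y : Ω | ∀ k, e k = i → y = Z k} = Set.univ := by
        ext y
        simp only [Set.mem_ofPred_eq, Set.mem_univ, iff_true]
        intro k hk
        exact absurd ⟨k, hk⟩ hi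
      rw [this, pr_univ, (hp i).sum_eq_one]
    · intro k
      have : {y : Ω | ∀ k', e k' = e k → y = Z k'} = {Z k} := by
        ext y
        simp only [Set.mem_ofPred_eq, Set.mem_singleton_iff]
        constructor
        · intro h
          exact h k rfl
        · rintro rfl k' hk'
          rw [he hk']
      rw [this]
      simp [pr_eq_sum_ite]
  · rw [if_neg hZ]
    have : {X : ι → Ω | X ∘ e = Z ∧ X ∈ {X | X ∘ e ∈ E}} = ∅ := by
      ext X
      simp only [Set.mem_ofPred_eq, Set.mem_empty_iff_false, iff_false]
      rintro ⟨rfl, h⟩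
      exact hZ h
    rw [this]
    simp [pr]

/-- Conditioning on the coordinates in `s`: each of the others contributes a factor `b`. -/
lemma pr_pw_split_le {p : ι → Ω → ℝ} (hp : ∀ i, IsWeight (p i)) (s : Finset ι)
    (E : Set (s → Ω)) (V : (s → Ω) → ι → Set Ω) (b : ℝ)
    (hV : ∀ Z ∈ E, ∀ i ∉ s, pr (p i) (V Z i) ≤ b) :
    pr (pw p) {X | (fun i : s => X i) ∈ E ∧ ∀ i ∉ s, X i ∈ V (fun i : s => X i) i}
      ≤ pr (pw fun i : s => p i) E * b ^ (sᶜ).card := by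
  rw [pr_eq_sum_pr_and (pw p) (fun X => fun i : s => X i), pr_eq_sum_ite, Finset.sum_mul]
  apply Finset.sum_le_sum
  intro Z _
  by_cases hZ : Z ∈ E
  · have : {X : ι → Ω | (fun i : s => X i) = Z ∧
        X ∈ {X : ι → Ω | (fun i : s => X i) ∈ E ∧ ∀ i ∉ s, X i ∈ V (fun i : s => X i) i}}
        = {X | ∀ i, X i ∈ {y | if h : i ∈ s then y = Z ⟨i, h⟩ else y ∈ V Z i}} := by
      ext X
      simp only [Set.mem_ofPred_eq]
      constructor
      · rintro ⟨rfl, -, h2⟩ i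
        by_cases hi : i ∈ s
        · simp [hi]
        · simp [hi, h2 i hi]
      · intro h
        have h1 : (fun i : s => X i) = Z := by
          funext i
          have := h i
          simpa [i.2] using this
        refine ⟨h1, h1 ▸ hZ, fun i hi => ?_⟩
        have := h i
        simpa [hi, h1] using this
    rw [this, pr_pw_box, if_pos hZ, pw, ← Finset.prod_mul_prod_compl s, ← Finset.prod_attach s]
    have e1 : ∏ i ∈ s.attach, pr (p i) {y | if h : (i : ι) ∈ s then y = Z ⟨i, h⟩ else y ∈ V Z i}
        = ∏ i : s, p i (Z i) := by
      rw [← Finset.univ_eq_attach]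
      apply Finset.prod_congr rfl
      intro i _
      simp [pr_eq_sum_ite]
    rw [e1]
    apply mul_le_mul_of_nonneg_left
    · rw [← Finset.prod_const]
      apply Finset.prod_le_prod
      · intro i _
        exact pr_nonneg (hp i).nonneg _
      · intro i hi
        have hi' : i ∉ s := by simpa using hi
        simpa [hi'] using hV Z hZ i hi'
    · exact Finset.prod_nonneg fun i _ => (hp i).nonneg _
  · have : {X : ι → Ω | (fun i : s => X i) = Z ∧
        X ∈ {X : ι → Ω | (fun i : s => X i) ∈ E ∧ ∀ i ∉ s, X i ∈ V (fun i : s => X i) i}} = ∅ := by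
      ext X
      simp only [Set.mem_ofPred_eq, Set.mem_empty_iff_false, iff_false]
      rintro ⟨rfl, h, -⟩
      exact hZ h
    rw [this, if_neg hZ]
    simp [pr]

/-- Independent blocks of coordinates. -/
lemma pr_pw_sum_elim (p : ι → Ω → ℝ) (p' : κ → Ω → ℝ) (A : Set (ι → Ω)) (B : Set (κ → Ω)) :
    pr (pw (Sum.elim p p')) {Z | Z ∘ Sum.inl ∈ A ∧ Z ∘ Sum.inr ∈ B}
      = pr (pw p) A * pr (pw p') B := by
  simp only [pr_eq_sum_ite]
  rw [← (Equiv.sumArrowEquivProdArrow ι κ Ω).symm.sum_comp, Fintype.sum_prod_type,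
    Finset.sum_mul_sum]
  apply Finset.sum_congr rfl
  intro X _
  apply Finset.sum_congr rfl
  intro Y _
  have h1 : (Equiv.sumArrowEquivProdArrow ι κ Ω).symm (X, Y) = Sum.elim X Y := rfl
  rw [h1]
  simp only [Set.mem_ofPred_eq, Sum.elim_comp_inl, Sum.elim_comp_inr]
  by_cases hX : X ∈ A <;> by_cases hY : Y ∈ B <;> simp [hX, hY, pw]

end Weights

/-! ### Squares of seminorms on finite groups. -/

section SqNorm

open Finset
open scoped Classical Pointwise

/-- A function whose square root is a (group) seminorm. -/
structure IsSqNorm {G : Type*} [AddCommGroup G] (h : G → ℝ) : Prop where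
  nonneg : ∀ x, 0 ≤ h x
  zero : h 0 = 0
  neg : ∀ x, h (-x) = h x
  sqrt_add : ∀ x y, √(h (x + y)) ≤ √(h x) + √(h y)

variable {G G' : Type*} [AddCommGroup G] [AddCommGroup G']

lemma IsSqNorm.comp {h : G → ℝ} (hh : IsSqNorm h) (θ : G' →+ G) : IsSqNorm fun x => h (θ x) where
  nonneg x := hh.nonneg _
  zero := by simp [hh.zero]
  neg x := by simp [hh.neg]
  sqrt_add x y := by simpa using hh.sqrt_add (θ x) (θ y)

lemma IsSqNorm.sq_of_le {a : G → ℝ} (h0 : ∀ x, 0 ≤ a x) (hz : a 0 = 0) (hn : ∀ x, a (-x) = a x)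
    (hadd : ∀ x y, a (x + y) ≤ a x + a y) : IsSqNorm fun x => a x ^ 2 where
  nonneg x := sq_nonneg _
  zero := by simp [hz]
  neg x := by rw [hn]
  sqrt_add x y := by
    simpa only [Real.sqrt_sq (h0 _)] using hadd x y

lemma IsSqNorm.const_mul {h : G → ℝ} (hh : IsSqNorm h) {c : ℝ} (hc : 0 ≤ c) :
    IsSqNorm fun x => c * h x where
  nonneg x := mul_nonneg hc (hh.nonneg x)
  zero := by simp [hh.zero]
  neg x := by rw [hh.neg]
  sqrt_add x y := by
    rw [Real.sqrt_mul hc, Real.sqrt_mul hc, Real.sqrt_mul hc, ← mul_add]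
    exact mul_le_mul_of_nonneg_left (hh.sqrt_add x y) (Real.sqrt_nonneg c)

/-- Minkowski's inequality for the `ℓ²` norm of the vector of seminorms `√(h i)`, proved from
Cauchy–Schwarz. -/
lemma IsSqNorm.sum {τ : Type*} (s : Finset τ) {h : τ → G → ℝ} (hh : ∀ i ∈ s, IsSqNorm (h i)) :
    IsSqNorm fun x => ∑ i ∈ s, h i x where
  nonneg x := Finset.sum_nonneg fun i hi => (hh i hi).nonneg x
  zero := Finset.sum_eq_zero fun i hi => (hh i hi).zero
  neg x := Finset.sum_congr rfl fun i hi => (hh i hi).neg x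
  sqrt_add x y := by
    have hx := Finset.sum_nonneg fun i hi => (hh i hi).nonneg x
    have hy := Finset.sum_nonneg fun i hi => (hh i hi).nonneg y
    rw [Real.sqrt_le_left (by positivity)]
    have hcs := Real.sum_mul_le_sqrt_mul_sqrt s (fun i => √(h i x)) (fun i => √(h i y))
    rw [Finset.sum_congr rfl fun i hi => Real.sq_sqrt ((hh i hi).nonneg x),
      Finset.sum_congr rfl fun i hi => Real.sq_sqrt ((hh i hi).nonneg y)] at hcs
    calc ∑ i ∈ s, h i (x + y) ≤ ∑ i ∈ s, (h i x + h i y + 2 * (√(h i x) * √(h i y))) := by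
          apply Finset.sum_le_sum
          intro i hi
          have h1 := (Real.sqrt_le_left (by positivity)).1 ((hh i hi).sqrt_add x y)
          have h2 := Real.sq_sqrt ((hh i hi).nonneg x)
          have h3 := Real.sq_sqrt ((hh i hi).nonneg y)
          nlinarith
      _ = ∑ i ∈ s, h i x + ∑ i ∈ s, h i y + 2 * ∑ i ∈ s, √(h i x) * √(h i y) := by
          rw [Finset.sum_add_distrib, Finset.sum_add_distrib, Finset.mul_sum]
      _ ≤ _ := by
          have h2 := Real.sq_sqrt hx
          have h3 := Real.sq_sqrt hy
          nlinarith

/-- If the average of a squared seminorm on a finite group is at least `a`, then at most half of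
the group has value at most `a / 5`. -/
lemma IsSqNorm.two_mul_card_le [Fintype G] {h : G → ℝ} (hh : IsSqNorm h) {a : ℝ} (ha : 0 < a)
    (havg : a * Fintype.card G ≤ ∑ x, h x) :
    2 * #{x | h x ≤ a / 5} ≤ Fintype.card G := by
  by_contra! hcon
  set A : Finset G := {x | h x ≤ a / 5} with hA
  have key : ∀ x, h x ≤ 4 * (a / 5) := by
    intro x
    have hc : #(A.image fun y => x - y) = #A :=
      Finset.card_image_of_injective _ sub_right_injective
    -- `A` and `x - A` each fill more than half of the group, so they meet and `x ∈ A + A`. Hence `h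
    -- ≤ 4a/5` everywhere, against the average `a`.
    obtain ⟨y, hy⟩ := Finset.inter_nonempty_of_card_lt_card_add_card (Finset.subset_univ A)
      (Finset.subset_univ (A.image fun y => x - y)) (by rw [hc, Finset.card_univ]; omega)
    rw [Finset.mem_inter, Finset.mem_image] at hy
    obtain ⟨hy1, z, hz, hzy⟩ := hy
    have hx : x = y + z := by rw [← hzy]; abel
    have h1 : √(h y) ≤ √(a / 5) := Real.sqrt_le_sqrt (by simpa [hA] using hy1)
    have h2 : √(h z) ≤ √(a / 5) := Real.sqrt_le_sqrt (by simpa [hA] using hz)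
    have h3 := hh.sqrt_add y z
    rw [← hx] at h3
    have h4 : √(h x) ≤ 2 * √(a / 5) := by linarith
    rw [Real.sqrt_le_left (by positivity), mul_pow, Real.sq_sqrt (by positivity)] at h4
    linarith
  have : ∑ x, h x ≤ Fintype.card G * (4 * (a / 5)) := by
    rw [← nsmul_eq_mul, ← Finset.card_univ]
    exact Finset.sum_le_card_nsmul _ _ _ fun x _ => key x
  have hG : (0 : ℝ) < Fintype.card G := Nat.cast_pos.2 Fintype.card_pos
  nlinarith

/-- At least half of the points have `h > a/5`, where the summand is at most `exp (-1) ≤ 4/10`;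
elsewhere it is at most `1`. The average is then at most `7/10`. -/
lemma IsSqNorm.sum_exp_le [Fintype G] {h : G → ℝ} (hh : IsSqNorm h) {a s : ℝ} (ha : 0 < a)
    (hs : 0 ≤ s) (hsa : 5 ≤ s * a) (havg : a * Fintype.card G ≤ ∑ x, h x) :
    ∑ x, Real.exp (-(s * h x)) ≤ 7 / 10 * Fintype.card G := by
  have h2 := hh.two_mul_card_le ha havg
  have he : Real.exp (-1) ≤ 4 / 10 := by
    have := Real.exp_neg_one_lt_d9
    linarith
  have h3 : ∀ x, Real.exp (-(s * h x)) ≤ 4 / 10 + if h x ≤ a / 5 then 6 / 10 else 0 := by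
    intro x
    split_ifs with hx
    · have : Real.exp (-(s * h x)) ≤ 1 :=
        Real.exp_le_one_iff.2 (neg_nonpos.2 (mul_nonneg hs (hh.nonneg x)))
      linarith
    · push Not at hx
      have h5 : s * (a / 5) ≤ s * h x := mul_le_mul_of_nonneg_left hx.le hs
      have : Real.exp (-(s * h x)) ≤ Real.exp (-1) := Real.exp_le_exp.2 (by linarith)
      linarith
  calc ∑ x, Real.exp (-(s * h x)) ≤ ∑ x, (4 / 10 + if h x ≤ a / 5 then 6 / 10 else (0 : ℝ)) :=
        Finset.sum_le_sum fun x _ => h3 x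
    _ = 4 / 10 * Fintype.card G + 6 / 10 * #{x | h x ≤ a / 5} := by
        rw [Finset.sum_add_distrib, Finset.sum_const, Finset.card_univ, nsmul_eq_mul,
          ← Finset.sum_filter, Finset.sum_const, nsmul_eq_mul]
        ring
    _ ≤ _ := by
        have : (2 * #{x | h x ≤ a / 5} : ℝ) ≤ Fintype.card G := by exact_mod_cast h2
        linarith

/-! ### Linear growth of level sets. -/

section Growth

lemma IsSqNorm.sqrt_le_of_mem_nsmul {h : G → ℝ} (hh : IsSqNorm h) {A : Finset G} {t : ℝ}
    (hA : ∀ x ∈ A, √(h x) ≤ t) (j : ℕ) : ∀ x ∈ j • A, √(h x) ≤ j * t := by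
  induction j with
  | zero =>
    intro x hx
    have : x = 0 := by simpa using hx
    simp [this, hh.zero]
  | succ j ih =>
    intro x hx
    rw [succ_nsmul, Finset.mem_add] at hx
    obtain ⟨y, hy, z, hz, rfl⟩ := hx
    have := hh.sqrt_add y z
    have := ih y hy
    have := hA z hz
    push_cast
    linarith

lemma nsmul_subset_nsmul_of_le {A : Finset G} (h0 : (0 : G) ∈ A) {i j : ℕ} (hij : i ≤ j) :
    i • A ⊆ j • A := by
  obtain ⟨k, rfl⟩ := Nat.exists_eq_add_of_le hij
  intro x hx
  rw [add_nsmul, Finset.mem_add]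
  exact ⟨x, hx, 0, by
    have := Finset.nsmul_mem_nsmul (n := k) h0
    simpa using this, add_zero x⟩

/-- If the sumsets of a symmetric set `A` stabilize then they contain a nontrivial subgroup. -/
lemma exists_addSubgroup_of_nsmul_eq {A : Finset G} (h0 : (0 : G) ∈ A) (hneg : ∀ x ∈ A, -x ∈ A)
    (hA : ∃ x ∈ A, x ≠ 0) {j : ℕ} (h : (j + 1) • A ⊆ j • A) :
    ∃ H : AddSubgroup G, H ≠ ⊥ ∧ ∀ x ∈ H, x ∈ j • A := by
  have hadd : ∀ x ∈ AddSubgroup.closure (A : Set G), x ∈ j • A := by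
    intro x hx
    induction hx using AddSubgroup.closure_induction_right with
    | zero => simpa using Finset.nsmul_mem_nsmul (n := j) h0
    | add_right x hx y hy ih =>
      apply h
      rw [succ_nsmul, Finset.mem_add]
      exact ⟨x, ih, y, hy, rfl⟩
    | add_neg_cancel x hx y hy ih =>
      apply h
      rw [succ_nsmul, Finset.mem_add]
      exact ⟨x, ih, -y, hneg y hy, rfl⟩
  refine ⟨AddSubgroup.closure (A : Set G), ?_, hadd⟩
  obtain ⟨x, hx, hx0⟩ := hA
  intro hbot
  have : x ∈ AddSubgroup.closure (A : Set G) := AddSubgroup.subset_closure hx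
  rw [hbot, AddSubgroup.mem_bot] at this
  exact hx0 this

variable [Fintype G]

/-- Level sets grow linearly as long as no nontrivial subgroup lies in the large level set. -/
lemma IsSqNorm.card_level_le {h : G → ℝ} (hh : IsSqNorm h) {R t : ℝ}
    (hR : ∀ H : AddSubgroup G, H ≠ ⊥ → ∃ x ∈ H, R < √(h x)) (m : ℕ)
    (ht : (3 * m + 1) * t ≤ R) :
    (m + 1) * #{x | x ≠ 0 ∧ √(h x) ≤ t} ≤ #{x | √(h x) ≤ (3 * m + 1) * t} := by
  by_cases hne : ∃ x, x ≠ 0 ∧ √(h x) ≤ t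
  swap
  · have : ({x | x ≠ 0 ∧ √(h x) ≤ t} : Finset G) = ∅ := by
      apply Finset.filter_eq_empty_iff.2
      intro x _ hx
      exact hne ⟨x, hx⟩
    rw [this]
    simp
  obtain ⟨x0, hx0, hx0t⟩ := hne
  have ht0 : 0 ≤ t := (Real.sqrt_nonneg _).trans hx0t
  set A : Finset G := {x | √(h x) ≤ t} with hAdef
  have hA0 : (0 : G) ∈ A := by simp [hAdef, hh.zero, ht0]
  have hAneg : ∀ x ∈ A, -x ∈ A := by
    intro x hx
    simpa [hAdef, hh.neg] using hx
  have hAt : ∀ x ∈ A, √(h x) ≤ t := by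
    intro x hx
    simpa [hAdef] using hx
  -- If the sumsets stabilized at `j`, a nontrivial subgroup would lie in `j • A`, where `√h ≤ j * t
  -- ≤ R`, contradicting `hR`.
  have hgrow : ∀ j : ℕ, j ≤ 3 * m → ∃ y ∈ (j + 1) • A, y ∉ j • A := by
    intro j hjm
    by_contra! hcon
    obtain ⟨H, hH, hHA⟩ := exists_addSubgroup_of_nsmul_eq hA0 hAneg
      ⟨x0, by simpa [hAdef] using hx0t, hx0⟩ hcon
    obtain ⟨x, hx, hxR⟩ := hR H hH
    have h1 := hh.sqrt_le_of_mem_nsmul hAt j x (hHA x hx)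
    have h2 : (j : ℝ) ≤ 3 * m := by exact_mod_cast hjm
    nlinarith
  -- Spacing the new elements three apart makes the `m + 1` translates `y i + A` disjoint: a
  -- collision with `i < i'` would put `y i'` in `(3 * i + 2) • A`, inside `(3 * i' - 1) • A`. All
  -- translates lie in `(3 * m + 1) • A`.
  have hgrow' : ∀ i : ℕ, ∃ y : G, i ≤ m → y ∈ (3 * i) • A ∧ (1 ≤ i → y ∉ (3 * i - 1) • A) := by
    intro i
    rcases Nat.eq_zero_or_pos i with rfl | hi
    · exact ⟨0, fun _ => ⟨by simp, by simp⟩⟩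
    · by_cases him : i ≤ m
      · obtain ⟨y, hy1, hy2⟩ := hgrow (3 * i - 1) (by omega)
        refine ⟨y, fun _ => ⟨?_, fun _ => hy2⟩⟩
        rwa [show 3 * i - 1 + 1 = 3 * i by omega] at hy1
      · exact ⟨0, fun h => absurd h him⟩
  choose y hy using hgrow'
  have hcard : #((Finset.range (m + 1) ×ˢ A).image fun p => y p.1 + p.2) = (m + 1) * #A := by
    rw [Finset.card_image_of_injOn, Finset.card_product, Finset.card_range]
    have aux : ∀ i i' : ℕ, ∀ a ∈ A, ∀ a' ∈ A, i < i' → i' ≤ m → y i + a ≠ y i' + a' := by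
      intro i i' a ha a' ha' hlt hle heq
      have h1 := (hy i' hle).2 (by omega)
      apply h1
      apply nsmul_subset_nsmul_of_le hA0 (show 3 * i + 2 ≤ 3 * i' - 1 by omega)
      have : y i' = y i + (a + -a') := by
        rw [← add_assoc, heq]
        abel
      rw [this, add_nsmul]
      refine Finset.add_mem_add (hy i (by omega)).1 ?_
      rw [two_nsmul]
      exact Finset.add_mem_add ha (hAneg _ ha')
    rintro ⟨i, a⟩ hi ⟨i', a'⟩ hi' heq
    simp only [Finset.coe_product, Set.mem_prod, Finset.mem_coe, Finset.mem_range] at hi hi'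
    simp only at heq
    rcases lt_trichotomy i i' with hlt | rfl | hlt
    · exact absurd heq (aux i i' a hi.2 a' hi'.2 hlt (by omega))
    · rw [add_left_cancel heq]
    · exact absurd heq.symm (aux i' i a' hi'.2 a hi.2 hlt (by omega))
  calc (m + 1) * #{x | x ≠ 0 ∧ √(h x) ≤ t} ≤ (m + 1) * #A := by
        apply Nat.mul_le_mul_left
        apply Finset.card_le_card
        intro x hx
        simp only [Finset.mem_filter, Finset.mem_univ, true_and, hAdef] at hx ⊢
        exact hx.2
    _ = _ := hcard.symm
    _ ≤ _ := by
        apply Finset.card_le_card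
        intro x hx
        rw [Finset.mem_image] at hx
        obtain ⟨⟨i, a⟩, hia, rfl⟩ := hx
        simp only [Finset.mem_product, Finset.mem_range] at hia
        have h1 : y i + a ∈ (3 * m + 1) • A := by
          apply nsmul_subset_nsmul_of_le hA0 (show 3 * i + 1 ≤ 3 * m + 1 by omega)
          rw [succ_nsmul]
          exact Finset.add_mem_add (hy i (by omega)).1 hia.2
        have h2 := hh.sqrt_le_of_mem_nsmul hAt _ _ h1
        simp only [Finset.mem_filter, Finset.mem_univ, true_and]
        exact_mod_cast h2

end Growth

/-- Comparison of sums of an antitone function from comparison of distribution functions. -/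
lemma mul_sum_le_sum_of_card_level_le {β γ : Type*} (B : Finset β) (C : Finset γ) (a : β → ℝ)
    (b : γ → ℝ) (M : ℕ) (h : ∀ x ∈ B, M * #{x' ∈ B | a x' ≤ a x} ≤ #{y ∈ C | b y ≤ a x})
    (φ : ℝ → ℝ) (hφ : Antitone φ) (hφ0 : ∀ x, 0 ≤ φ x) :
    M * ∑ x ∈ B, φ (a x) ≤ ∑ y ∈ C, φ (b y) := by
  -- Hall's theorem matches `M` copies of each `x ∈ B` injectively with elements `y ∈ C` having `b y
  -- ≤ a x`. Hall's condition for `s` follows from the hypothesis at the member of `s` with largest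
  -- `a`.
  have hall := (Finset.all_card_le_biUnion_card_iff_exists_injective
    (fun p : B × Fin M => {y ∈ C | b y ≤ a p.1})).1 (by
      intro s
      rcases s.eq_empty_or_nonempty with rfl | hs
      · simp
      obtain ⟨p, hp, hmax⟩ := s.exists_max_image (fun p => a p.1) hs
      have h1 : #s ≤ M * #{x' ∈ B | a x' ≤ a p.1} := by
        calc #s ≤ #({x' ∈ B | a x' ≤ a p.1} ×ˢ (Finset.univ : Finset (Fin M))) := by
              apply Finset.card_le_card_of_injOn (fun q => ((q.1 : β), q.2))
              · intro q hq
                simpa using hmax q hq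
              · rintro ⟨⟨q1, h1⟩, q2⟩ _ ⟨⟨q1', h1'⟩, q2'⟩ _ heq
                simpa using heq
          _ = _ := by rw [Finset.card_product, Finset.card_univ, Fintype.card_fin, mul_comm]
      exact (h1.trans (h p.1 p.1.2)).trans (Finset.card_le_card
        (Finset.subset_biUnion_of_mem (fun p : B × Fin M => {y ∈ C | b y ≤ a p.1}) hp)))
  obtain ⟨σ, hσ, hσm⟩ := hall
  calc M * ∑ x ∈ B, φ (a x) = ∑ p : B × Fin M, φ (a p.1) := by
        rw [Fintype.sum_prod_type]
        simp only [Finset.sum_const, Finset.card_univ, Fintype.card_fin, nsmul_eq_mul]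
        rw [← Finset.mul_sum, Finset.univ_eq_attach, Finset.sum_attach B fun x => φ (a x)]
    _ ≤ ∑ p : B × Fin M, φ (b (σ p)) := by
        apply Finset.sum_le_sum
        intro p _
        have := hσm p
        simp only [Finset.mem_filter] at this
        exact hφ this.2
    _ = ∑ y ∈ Finset.univ.image σ, φ (b y) := by
        rw [Finset.sum_image fun _ _ _ _ h => hσ h]
    _ ≤ _ := by
        apply Finset.sum_le_sum_of_subset_of_nonneg
        · intro y hy
          rw [Finset.mem_image] at hy
          obtain ⟨p, _, rfl⟩ := hy
          have := hσm p
          simp only [Finset.mem_filter] at this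
          exact this.1
        · intro y _ _
          exact hφ0 _

/-- Halász-type comparison of exponential sums at two scales. -/
lemma IsSqNorm.sum_exp_ne_zero_le [Fintype G] {h : G → ℝ} (hh : IsSqNorm h) {T : ℝ} (hT : 0 ≤ T)
    (hsub : ∀ H : AddSubgroup G, H ≠ ⊥ → ∃ x ∈ H, T < h x) (m : ℕ) (hm : 1 ≤ m) :
    ∑ x with x ≠ 0, Real.exp (-(h x / 2))
      ≤ (1 / (m + 1) + Real.exp (-(T / (4 * (3 * m + 1) ^ 2)))) *
        ∑ x, Real.exp (-(h x / (2 * (3 * m + 1) ^ 2))) := by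
  set L : ℝ := 3 * m + 1 with hL
  have hm' : (1 : ℝ) ≤ m := by exact_mod_cast hm
  have hL4 : 4 ≤ L := by linarith
  have hL2 : 2 ≤ L ^ 2 := by nlinarith
  have hsub' : ∀ H : AddSubgroup G, H ≠ ⊥ → ∃ x ∈ H, √T < √(h x) := by
    intro H hH
    obtain ⟨x, hx, hxT⟩ := hsub H hH
    exact ⟨x, hx, Real.sqrt_lt_sqrt hT hxT⟩
  -- Where `L ^ 2 * h x ≤ T`, the growth of level sets compares `h` with `h / L ^ 2` and saves a
  -- factor `m + 1`. Elsewhere `h x / 2` is at least `T / (4 * L ^ 2) + h x / (2 * L ^ 2)` outright.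
  have hsplit : ∑ x with x ≠ 0, Real.exp (-(h x / 2))
      = ∑ x with x ≠ 0 ∧ L ^ 2 * h x ≤ T, Real.exp (-(h x / 2))
        + ∑ x with x ≠ 0 ∧ ¬ L ^ 2 * h x ≤ T, Real.exp (-(h x / 2)) := by
    rw [← Finset.filter_filter, ← Finset.filter_filter, Finset.sum_filter_add_sum_filter_not]
  rw [hsplit, add_mul]
  apply add_le_add
  · have key := mul_sum_le_sum_of_card_level_le ({x | x ≠ 0 ∧ L ^ 2 * h x ≤ T} : Finset G)
      Finset.univ (fun x => h x) (fun x => h x / L ^ 2) (m + 1) (by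
        intro x hx
        simp only [Finset.mem_filter, Finset.mem_univ, true_and] at hx
        have hlt : (3 * m + 1) * √(h x) ≤ √T := by
          rw [← hL]
          apply Real.le_sqrt_of_sq_le
          rw [mul_pow, Real.sq_sqrt (hh.nonneg x)]
          exact hx.2
        have := hh.card_level_le hsub' m hlt
        refine le_trans (Nat.mul_le_mul_left _ (Finset.card_le_card ?_))
          (this.trans (Finset.card_le_card ?_))
        · intro y hy
          simp only [Finset.mem_filter, Finset.mem_univ, true_and] at hy ⊢
          exact ⟨hy.1.1, Real.sqrt_le_sqrt hy.2⟩
        · intro y hy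
          simp only [Finset.mem_filter, Finset.mem_univ, true_and] at hy ⊢
          rw [← hL, Real.sqrt_le_left (by positivity), mul_pow, Real.sq_sqrt (hh.nonneg x)] at hy
          rw [div_le_iff₀ (by positivity)]
          linarith)
      (fun x => Real.exp (-(x / 2))) (fun x y hxy => Real.exp_le_exp.2 (by linarith))
      (fun x => (Real.exp_pos _).le)
    have e : ∀ x, Real.exp (-(h x / L ^ 2 / 2)) = Real.exp (-(h x / (2 * L ^ 2))) := by
      intro x
      rw [div_div, mul_comm (L ^ 2)]
    simp only [e] at key
    rw [div_mul_eq_mul_div, one_mul, le_div_iff₀ (by positivity), mul_comm]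
    exact_mod_cast key
  · rw [Finset.mul_sum]
    calc ∑ x with x ≠ 0 ∧ ¬ L ^ 2 * h x ≤ T, Real.exp (-(h x / 2))
        ≤ ∑ x with x ≠ 0 ∧ ¬ L ^ 2 * h x ≤ T,
          Real.exp (-(T / (4 * L ^ 2))) * Real.exp (-(h x / (2 * L ^ 2))) := by
          apply Finset.sum_le_sum
          intro x hx
          simp only [Finset.mem_filter, Finset.mem_univ, true_and, not_le] at hx
          rw [← Real.exp_add, Real.exp_le_exp]
          have h1 : T / L ^ 2 ≤ h x := by
            rw [div_le_iff₀ (by positivity)]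
            linarith [hx.2]
          have h2 : h x / L ^ 2 ≤ h x / 2 := by
            apply div_le_div_of_nonneg_left (hh.nonneg x) (by norm_num) hL2
          have e1 : T / (4 * L ^ 2) = T / L ^ 2 / 4 := by rw [div_div, mul_comm]
          have e2 : h x / (2 * L ^ 2) = h x / L ^ 2 / 2 := by rw [div_div, mul_comm]
          rw [e1, e2]
          linarith
      _ ≤ _ := by
          apply Finset.sum_le_sum_of_subset_of_nonneg (Finset.subset_univ _)
          intro x _ _
          positivity

end SqNorm

/-! ### Characteristic functions and their defects. -/

section Fourier

open Finset
open scoped Classical ComplexConjugate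

variable {F : Type*} [Field F] [Fintype F]

/-- A weight function on `F` is `α`-balanced if cosets of proper additive subgroups have mass at
most `1 - α`. -/
def WBalanced (α : ℝ) (w : F → ℝ) : Prop :=
  ∀ H : AddSubgroup F, H ≠ ⊤ → ∀ x : F, pr w {y | y - x ∈ H} ≤ 1 - α

/-- The characteristic function of a weight function. -/
noncomputable def hat (ψ : AddChar F ℂ) (w : F → ℝ) (v : F) : ℂ :=
  ∑ x, (w x : ℂ) * ψ (v * x)

/-- One minus the squared modulus of the characteristic function, written as a mean square. -/
noncomputable def defect (ψ : AddChar F ℂ) (w : F → ℝ) (v : F) : ℝ :=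
  ∑ x, ∑ x', w x * w x' / 2 * ‖1 - ψ (v * (x - x'))‖ ^ 2

/-- The sum of the defects of the coordinates. -/
noncomputable def rowDefect {ι : Type*} [Fintype ι] (ψ : AddChar F ℂ) (w : ι → F → ℝ) (v : ι → F) :
    ℝ :=
  ∑ j, defect ψ (w j) (v j)

/-- The law that is `0` with probability `1 - β`, and otherwise the difference of two independent
copies. -/
noncomputable def lazy (β : ℝ) (w : F → ℝ) (y : F) : ℝ :=
  (1 - β) * (if y = 0 then 1 else 0) + β * ∑ x, w x * w (x - y)

variable (ψ : AddChar F ℂ)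

lemma isSqNorm_one_sub_addChar {G : Type*} [AddCommGroup G] [Finite G] (χ : AddChar G ℂ) :
    IsSqNorm fun x => ‖1 - χ x‖ ^ 2 := by
  apply IsSqNorm.sq_of_le
  · intro x
    exact norm_nonneg _
  · simp
  · intro x
    rw [AddChar.map_neg_eq_conj, ← RCLike.norm_conj]
    simp
  · intro x y
    rw [AddChar.map_add_eq_mul]
    calc ‖1 - χ x * χ y‖ = ‖(1 - χ x) + χ x * (1 - χ y)‖ := by ring_nf
      _ ≤ ‖1 - χ x‖ + ‖χ x * (1 - χ y)‖ := norm_add_le _ _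
      _ = _ := by rw [norm_mul, AddChar.norm_apply, one_mul]

/-- `‖1 - χ‖` is subadditive for a character `χ`, and the defect is a nonnegative combination of
squares of such functions. -/
lemma isSqNorm_defect {w : F → ℝ} (hw : ∀ x, 0 ≤ w x) : IsSqNorm (defect ψ w) := by
  apply IsSqNorm.sum
  intro x _
  apply IsSqNorm.sum
  intro x' _
  apply IsSqNorm.const_mul _ (by have := hw x; have := hw x'; positivity)
  exact (isSqNorm_one_sub_addChar ψ).comp (AddMonoidHom.mulRight (x - x'))

lemma isSqNorm_rowDefect {ι : Type*} [Fintype ι] {w : ι → F → ℝ} (hw : ∀ j x, 0 ≤ w j x) :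
    IsSqNorm (rowDefect ψ w) := by
  apply IsSqNorm.sum
  intro j _
  exact (isSqNorm_defect ψ (hw j)).comp (Pi.evalAddMonoidHom (fun _ => F) j)

lemma half_norm_one_sub_sq {z : ℂ} (hz : ‖z‖ = 1) : ‖1 - z‖ ^ 2 / 2 = 1 - z.re := by
  have h1 : z.re * z.re + z.im * z.im = 1 := by
    have := Complex.normSq_eq_norm_sq z
    rw [hz, Complex.normSq_apply] at this
    simpa using this
  rw [← Complex.normSq_eq_norm_sq, Complex.normSq_apply]
  simp only [Complex.sub_re, Complex.one_re, Complex.sub_im, Complex.one_im]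
  nlinarith

lemma hat_mul_conj (w : F → ℝ) (v : F) :
    hat ψ w v * conj (hat ψ w v) = ∑ x, ∑ x', (w x * w x' : ℂ) * ψ (v * (x - x')) := by
  unfold hat
  rw [map_sum, Finset.sum_mul_sum]
  apply Finset.sum_congr rfl
  intro x _
  apply Finset.sum_congr rfl
  intro x' _
  rw [map_mul (starRingEnd ℂ), Complex.conj_ofReal, ← AddChar.map_neg_eq_conj, mul_sub, sub_eq_add_neg,
    AddChar.map_add_eq_mul]
  ring

/-- The squared modulus is the mean of `Re ψ (v * (x - x'))` over two independent copies, and `1 -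
Re z = ‖1 - z‖ ^ 2 / 2` on the unit circle. -/
lemma norm_hat_sq {w : F → ℝ} (hw : IsWeight w) (v : F) :
    ‖hat ψ w v‖ ^ 2 = 1 - defect ψ w v := by
  have h1 : (‖hat ψ w v‖ ^ 2 : ℝ) = ∑ x, ∑ x', w x * w x' * (ψ (v * (x - x'))).re := by
    have h2 := hat_mul_conj ψ w v
    rw [Complex.mul_conj, Complex.normSq_eq_norm_sq] at h2
    have h3 := congrArg Complex.re h2
    rw [Complex.ofReal_re] at h3
    rw [h3]
    simp only [Complex.re_sum]
    apply Finset.sum_congr rfl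
    intro x _
    apply Finset.sum_congr rfl
    intro x' _
    rw [← Complex.ofReal_mul, Complex.re_ofReal_mul]
  have h2 : defect ψ w v = ∑ x, ∑ x', w x * w x' * (1 - (ψ (v * (x - x'))).re) := by
    unfold defect
    apply Finset.sum_congr rfl
    intro x _
    apply Finset.sum_congr rfl
    intro x' _
    rw [← half_norm_one_sub_sq (AddChar.norm_apply ψ _)]
    ring
  have h3 : ∑ x, ∑ x', w x * w x' = 1 := by
    rw [← Finset.sum_mul_sum, hw.sum_eq_one, one_mul]
  have h4 : ‖hat ψ w v‖ ^ 2 + defect ψ w v = ∑ x, ∑ x', w x * w x' := by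
    rw [h1, h2, ← Finset.sum_add_distrib]
    apply Finset.sum_congr rfl
    intro x _
    rw [← Finset.sum_add_distrib]
    apply Finset.sum_congr rfl
    intro x' _
    ring
  linarith

lemma defect_le_one {w : F → ℝ} (hw : IsWeight w) (v : F) : defect ψ w v ≤ 1 := by
  have := norm_hat_sq ψ hw v
  nlinarith [sq_nonneg ‖hat ψ w v‖]

lemma norm_hat_le_exp {w : F → ℝ} (hw : IsWeight w) (v : F) :
    ‖hat ψ w v‖ ≤ Real.exp (-(defect ψ w v / 2)) := by
  apply le_of_sq_le_sq _ (Real.exp_pos _).le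
  rw [norm_hat_sq ψ hw, ← Real.exp_nat_mul]
  have := Real.add_one_le_exp (-defect ψ w v)
  calc 1 - defect ψ w v ≤ Real.exp (-defect ψ w v) := by linarith
    _ = _ := by
      congr 1
      push_cast
      ring

lemma prod_norm_hat_le {ι : Type*} [Fintype ι] {w : ι → F → ℝ} (hw : ∀ j, IsWeight (w j))
    (v : ι → F) : ∏ j, ‖hat ψ (w j) (v j)‖ ≤ Real.exp (-(rowDefect ψ w v / 2)) := by
  calc ∏ j, ‖hat ψ (w j) (v j)‖ ≤ ∏ j, Real.exp (-(defect ψ (w j) (v j) / 2)) :=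
        Finset.prod_le_prod (fun j _ => norm_nonneg _) fun j _ => norm_hat_le_exp ψ (hw j) _
    _ = _ := by
      rw [← Real.exp_sum, Finset.sum_neg_distrib, rowDefect, Finset.sum_div]

/-- Averaging over a group on which the `F`-coordinate is not identically zero. -/
lemma le_sum_defect (hψ : ψ 1 ≠ 1) {α : ℝ} {w : F → ℝ} (hw : IsWeight w) (hb : WBalanced α w)
    {H : Type*} [AddCommGroup H] [Fintype H] (θ : H →+ F) (hθ : ∃ h, θ h ≠ 0) :
    α * Fintype.card H ≤ ∑ h, defect ψ w (θ h) := by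
  -- `K` is the annihilator of the image of `θ` for the pairing `ψ (u * y)`. It is proper because a
  -- nonzero `θ h` is invertible and `ψ 1 ≠ 1`, so balancedness applies to its cosets.
  let K : AddSubgroup F :=
    { carrier := {y | ∀ h, ψ (θ h * y) = 1}
      zero_mem' := fun h => by simp
      add_mem' := fun {a b} ha hb h => by
        rw [mul_add, AddChar.map_add_eq_mul, ha h, hb h, one_mul]
      neg_mem' := fun {a} ha h => by
        rw [mul_neg, AddChar.map_neg_eq_inv, ha h, inv_one] }
  have hK : ∀ y, y ∈ K ↔ ∀ h, ψ (θ h * y) = 1 := fun y => Iff.rfl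
  have hKtop : K ≠ ⊤ := by
    intro htop
    obtain ⟨h, hh⟩ := hθ
    have : (θ h)⁻¹ ∈ K := htop ▸ AddSubgroup.mem_top _
    have := (hK _).1 this h
    rw [mul_inv_cancel₀ hh] at this
    exact hψ this
  -- Orthogonality of characters on `H`: the mean of `1 - Re χ` is `0` or `1` according to whether
  -- `χ` is trivial.
  have hpair : ∀ y : F, ∑ h, ‖1 - ψ (θ h * y)‖ ^ 2 / 2
      = if y ∈ K then 0 else (Fintype.card H : ℝ) := by
    intro y
    let χ : AddChar H ℂ := ψ.compAddMonoidHom ((AddMonoidHom.mulRight y).comp θ)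
    have hχ : ∀ h, χ h = ψ (θ h * y) := fun h => rfl
    split_ifs with hy
    · apply Finset.sum_eq_zero
      intro h _
      rw [(hK y).1 hy h]
      simp
    · have hne : χ ≠ 0 := by
        intro h0
        apply hy
        rw [hK]
        intro h
        rw [← hχ, h0]
        simp
      have hsum : ∑ h, χ h = 0 := AddChar.sum_eq_zero_iff_ne_zero.2 hne
      have : ∀ h, ‖1 - ψ (θ h * y)‖ ^ 2 / 2 = 1 - (χ h).re := fun h =>
        half_norm_one_sub_sq (AddChar.norm_apply ψ _)
      simp only [this]
      rw [Finset.sum_sub_distrib, ← Complex.re_sum, hsum]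
      simp
  have hexp : ∑ h, defect ψ w (θ h)
      = ∑ x', w x' * ∑ x, w x * (if x - x' ∈ K then 0 else (Fintype.card H : ℝ)) := by
    simp only [← hpair]
    unfold defect
    simp only [Finset.mul_sum]
    rw [Finset.sum_comm, Finset.sum_congr rfl fun x _ => Finset.sum_comm, Finset.sum_comm]
    apply Finset.sum_congr rfl
    intro x' _
    apply Finset.sum_congr rfl
    intro x _
    apply Finset.sum_congr rfl
    intro h _
    ring
  have hin : ∀ x', α * Fintype.card H
      ≤ ∑ x, w x * (if x - x' ∈ K then 0 else (Fintype.card H : ℝ)) := by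
    intro x'
    have h1 := hb K hKtop x'
    rw [pr_eq_sum_ite] at h1
    have h2 : ∑ x, w x * (if x - x' ∈ K then 0 else (Fintype.card H : ℝ))
        = (1 - ∑ x, if x ∈ {y | y - x' ∈ K} then w x else 0) * Fintype.card H := by
      rw [← hw.sum_eq_one, ← Finset.sum_sub_distrib, Finset.sum_mul]
      apply Finset.sum_congr rfl
      intro x _
      by_cases hx : x - x' ∈ K <;> simp [hx]
    rw [h2]
    apply mul_le_mul_of_nonneg_right _ (Nat.cast_nonneg _)
    linarith
  rw [hexp]
  calc α * Fintype.card H = ∑ x', w x' * (α * Fintype.card H) := by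
        rw [← Finset.sum_mul, hw.sum_eq_one, one_mul]
    _ ≤ _ := Finset.sum_le_sum fun x' _ => mul_le_mul_of_nonneg_left (hin x') (hw.nonneg x')

/-! ### The lazy symmetrized law. -/

section Lazy

variable {β : ℝ} {w : F → ℝ}

lemma sum_mul_sub_eq_one (hw : IsWeight w) : ∑ y, ∑ x, w x * w (x - y) = 1 := by
  rw [Finset.sum_comm]
  have : ∀ x, ∑ y, w x * w (x - y) = w x := by
    intro x
    have := (Equiv.subLeft x).sum_comp w
    simp only [Equiv.subLeft_apply] at this
    rw [← Finset.mul_sum, this, hw.sum_eq_one, mul_one]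
  simp only [this, hw.sum_eq_one]

lemma isWeight_lazy (hw : IsWeight w) (h0 : 0 ≤ β) (h1 : β ≤ 1) : IsWeight (lazy β w) where
  nonneg y := by
    have : 0 ≤ ∑ x, w x * w (x - y) :=
      Finset.sum_nonneg fun x _ => mul_nonneg (hw.nonneg _) (hw.nonneg _)
    unfold lazy
    have : (0 : ℝ) ≤ if y = 0 then 1 else 0 := by split_ifs <;> norm_num
    have : 0 ≤ 1 - β := by linarith
    positivity
  sum_eq_one := by
    unfold lazy
    rw [Finset.sum_add_distrib, ← Finset.mul_sum, ← Finset.mul_sum, sum_mul_sub_eq_one hw]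
    simp

lemma WBalanced.apply_le {α : ℝ} (hb : WBalanced α w) (x : F) : w x ≤ 1 - α := by
  have := hb ⊥ bot_ne_top x
  simpa [pr_eq_sum_ite, sub_eq_zero] using this

lemma lazy_le {α : ℝ} (hw : IsWeight w) (hb : WBalanced α w) (h0 : 0 ≤ β) (h1 : β ≤ 1 / 2)
    (y : F) : lazy β w y ≤ 1 - β * α := by
  have hle : ∑ x, w x * w (x - y) ≤ 1 - α := by
    calc ∑ x, w x * w (x - y) ≤ ∑ x, w x * (1 - α) :=
          Finset.sum_le_sum fun x _ => mul_le_mul_of_nonneg_left (hb.apply_le _) (hw.nonneg _)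
      _ = _ := by rw [← Finset.sum_mul, hw.sum_eq_one, one_mul]
  unfold lazy
  split_ifs <;> nlinarith

/-- The difference of two independent copies has transform `‖hat ψ w v‖ ^ 2`, that is, one minus the
defect. For `β ≤ 1/2` the lazy transform is real and at least `1/2`, so Fourier inversion for the
lazy law has no cancellation on a subspace. -/
lemma hat_lazy (hw : IsWeight w) (v : F) :
    hat ψ (lazy β w) v = ((1 - β * defect ψ w v : ℝ) : ℂ) := by
  have h2 : ∑ y, (∑ x, (w x : ℂ) * w (x - y)) * ψ (v * y) = ((1 - defect ψ w v : ℝ) : ℂ) := by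
    rw [← norm_hat_sq ψ hw, ← Complex.normSq_eq_norm_sq, ← Complex.mul_conj, hat_mul_conj]
    simp only [Finset.sum_mul]
    rw [Finset.sum_comm]
    apply Finset.sum_congr rfl
    intro x _
    rw [← (Equiv.subLeft x).sum_comp]
    apply Finset.sum_congr rfl
    intro x' _
    simp
  have h1 : hat ψ (lazy β w) v = (1 - β) + β * ∑ y, (∑ x, (w x : ℂ) * w (x - y)) * ψ (v * y) := by
    unfold hat lazy
    rw [Finset.mul_sum]
    push_cast
    simp only [add_mul]
    rw [Finset.sum_add_distrib]
    refine congrArg₂ (· + ·) ?_ ?_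
    · rw [Finset.sum_eq_single 0]
      · simp
      · intro y _ hy
        simp [hy]
      · simp
    · apply Finset.sum_congr rfl
      intro y _
      ring
  rw [h1, h2]
  push_cast
  ring

lemma exp_le_one_sub_mul {x : ℝ} (hx0 : 0 ≤ x) (hx : x ≤ 1 / 2) : Real.exp (-(2 * x)) ≤ 1 - x := by
  have h1 : 0 < 1 - x := by linarith
  have h2 := Real.add_one_le_exp (2 * x)
  rw [Real.exp_neg, inv_le_comm₀ (Real.exp_pos _) h1]
  calc (1 - x)⁻¹ ≤ 2 * x + 1 := by
        rw [inv_le_iff_one_le_mul₀ h1]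
        nlinarith
    _ ≤ _ := h2

end Lazy

end Fourier

/-! ### Orthogonal complements and Fourier inversion on cosets. -/

section Orth

open Finset
open scoped Classical

variable {F : Type*} [Field F] {n : ℕ}

/-- The orthogonal complement for the standard bilinear form. -/
noncomputable def orth (V : Submodule F (Fin n → F)) : Submodule F (Fin n → F) :=
  V.dualAnnihilator.comap (dotProductEquiv F (Fin n)).toLinearMap

lemma mem_orth {V : Submodule F (Fin n → F)} {v : Fin n → F} :
    v ∈ orth V ↔ ∀ w ∈ V, v ⬝ᵥ w = 0 := by
  simp [orth, Submodule.mem_dualAnnihilator]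

lemma finrank_add_codim (V : Submodule F (Fin n → F)) : Module.finrank F V + codim V = n := by
  rw [codim, add_comm, Submodule.finrank_quotient_add_finrank, Module.finrank_fin_fun]

lemma finrank_orth (V : Submodule F (Fin n → F)) : Module.finrank F (orth V) = codim V := by
  have h1 := Subspace.finrank_add_finrank_dualAnnihilator_eq V
  have h2 := finrank_add_codim V
  rw [Module.finrank_fin_fun] at h1
  have h3 : Module.finrank F (orth V) = Module.finrank F V.dualAnnihilator := by
    rw [orth, Submodule.comap_equiv_eq_map_symm]
    exact LinearEquiv.finrank_map_eq _ _
  omega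

lemma mem_of_forall_orth {V : Submodule F (Fin n → F)} {y : Fin n → F}
    (h : ∀ v ∈ orth V, v ⬝ᵥ y = 0) : y ∈ V := by
  by_contra hy
  obtain ⟨f, hf, hV⟩ := Submodule.exists_le_ker_of_notMem hy
  apply hf
  have h1 : ∀ w, (dotProductEquiv F (Fin n)).symm f ⬝ᵥ w = f w := fun w => by
    have := LinearMap.congr_fun ((dotProductEquiv F (Fin n)).apply_symm_apply f) w
    rw [← this]
    rfl
  rw [← h1]
  apply h
  rw [mem_orth]
  intro w hw
  rw [h1]
  exact hV hw

lemma orth_injective : Function.Injective (orth : Submodule F (Fin n → F) → _) := by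
  have key : ∀ V W : Submodule F (Fin n → F), orth V = orth W → V ≤ W := by
    intro V W h y hy
    apply mem_of_forall_orth
    intro v hv
    rw [← h] at hv
    exact mem_orth.1 hv y hy
  intro V W h
  exact le_antisymm (key V W h) (key W V h.symm)

variable [Fintype F]

lemma card_orth (V : Submodule F (Fin n → F)) :
    Fintype.card (orth V) = Fintype.card F ^ codim V := by
  rw [Module.card_eq_pow_finrank (K := F), finrank_orth]

variable (ψ : AddChar F ℂ)

lemma sum_orth_addChar (hψ : ψ 1 ≠ 1) (V : Submodule F (Fin n → F)) (y : Fin n → F) :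
    ∑ v : orth V, ψ ((v : Fin n → F) ⬝ᵥ y)
      = if y ∈ V then (Fintype.card F : ℂ) ^ codim V else 0 := by
  split_ifs with hy
  · rw [Finset.sum_congr rfl fun v _ => by rw [mem_orth.1 v.2 y hy, AddChar.map_zero_eq_one]]
    rw [Finset.sum_const, Finset.card_univ, card_orth]
    simp
  · have hex : ∃ v ∈ orth V, v ⬝ᵥ y ≠ 0 := by
      by_contra! hcon
      exact hy (mem_of_forall_orth hcon)
    obtain ⟨v, hv, hvy⟩ := hex
    let θ : orth V →+ F := AddMonoidHom.mk' (fun v => (v : Fin n → F) ⬝ᵥ y) (by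
      intro a b
      simp [add_dotProduct])
    have hne : ψ.compAddMonoidHom θ ≠ 0 := by
      intro h0
      have h1 : ψ.compAddMonoidHom θ ((v ⬝ᵥ y)⁻¹ • ⟨v, hv⟩) = 1 := by
        rw [h0]
        simp
      apply hψ
      rw [← h1]
      change _ = ψ ((((v ⬝ᵥ y)⁻¹ • (⟨v, hv⟩ : orth V) : orth V) : Fin n → F) ⬝ᵥ y)
      rw [Submodule.coe_smul, smul_dotProduct, smul_eq_mul, inv_mul_cancel₀ hvy]
    exact AddChar.sum_eq_zero_iff_ne_zero.2 hne

omit [Fintype F] in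
lemma addChar_sum {ι : Type*} (s : Finset ι) (f : ι → F) :
    ψ (∑ j ∈ s, f j) = ∏ j ∈ s, ψ (f j) := by
  induction s using Finset.induction_on with
  | empty => simp
  | insert a s ha ih => rw [Finset.sum_insert ha, Finset.prod_insert ha, AddChar.map_add_eq_mul, ih]

lemma prod_hat {ι : Type*} [Fintype ι] [DecidableEq ι] (w : ι → F → ℝ) (v : ι → F) :
    ∏ j, hat ψ (w j) (v j) = ∑ y, (pw w y : ℂ) * ψ (v ⬝ᵥ y) := by
  unfold hat
  rw [Finset.prod_univ_sum, Fintype.piFinset_univ]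
  apply Finset.sum_congr rfl
  intro y _
  rw [Finset.prod_mul_distrib, pw, dotProduct, addChar_sum]
  push_cast
  rfl

/-- Fourier inversion for the mass of a coset of a subspace. -/
lemma pr_coset_eq (hψ : ψ 1 ≠ 1) (w : Fin n → F → ℝ) (V : Submodule F (Fin n → F))
    (x : Fin n → F) :
    (pr (pw w) {y | y - x ∈ V} : ℂ) = 1 / (Fintype.card F : ℂ) ^ codim V *
      ∑ v : orth V, (∏ j, hat ψ (w j) ((v : Fin n → F) j)) * ψ (-((v : Fin n → F) ⬝ᵥ x)) := by
  have hq : (Fintype.card F : ℂ) ^ codim V ≠ 0 := by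
    simp
  have h1 : ∑ v : orth V, (∏ j, hat ψ (w j) ((v : Fin n → F) j)) * ψ (-((v : Fin n → F) ⬝ᵥ x))
      = ∑ y, (pw w y : ℂ) * ∑ v : orth V, ψ ((v : Fin n → F) ⬝ᵥ (y - x)) := by
    simp only [prod_hat, Finset.sum_mul, Finset.mul_sum]
    rw [Finset.sum_comm]
    refine Finset.sum_congr rfl fun y _ => Finset.sum_congr rfl fun v _ => ?_
    rw [dotProduct_sub, sub_eq_add_neg, AddChar.map_add_eq_mul]
    ring
  rw [h1, pr_eq_sum_ite, Finset.mul_sum]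
  push_cast
  apply Finset.sum_congr rfl
  intro y _
  rw [sum_orth_addChar ψ hψ]
  by_cases hy : y - x ∈ V
  · simp only [hy, Set.mem_ofPred_eq, if_true]
    field_simp
  · simp [hy]

/-- The zero frequency contributes exactly the uniform mass, and the others are bounded in absolute
value. -/
lemma abs_pr_coset_sub_le (hψ : ψ 1 ≠ 1) {w : Fin n → F → ℝ} (hw : ∀ j, IsWeight (w j))
    (V : Submodule F (Fin n → F)) (x : Fin n → F) :
    |pr (pw w) {y | y - x ∈ V} - 1 / (Fintype.card F : ℝ) ^ codim V|
      ≤ 1 / (Fintype.card F : ℝ) ^ codim V *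
        ∑ v : orth V with v ≠ 0, Real.exp (-(rowDefect ψ w v / 2)) := by
  have h0 : (∏ j, hat ψ (w j) (((0 : orth V) : Fin n → F) j)) *
      ψ (-(((0 : orth V) : Fin n → F) ⬝ᵥ x)) = 1 := by
    have : ∀ j, hat ψ (w j) 0 = 1 := by
      intro j
      simp only [hat, zero_mul, AddChar.map_zero_eq_one, mul_one]
      exact_mod_cast (hw j).sum_eq_one
    simp [this]
  have h1 := pr_coset_eq ψ hψ w V x
  rw [← Finset.add_sum_erase _ _ (Finset.mem_univ (0 : orth V)), h0, mul_add, mul_one] at h1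
  have h2 : ((pr (pw w) {y | y - x ∈ V} - 1 / (Fintype.card F : ℝ) ^ codim V : ℝ) : ℂ)
      = 1 / (Fintype.card F : ℂ) ^ codim V * ∑ v ∈ Finset.univ.erase (0 : orth V),
        (∏ j, hat ψ (w j) ((v : Fin n → F) j)) * ψ (-((v : Fin n → F) ⬝ᵥ x)) := by
    push_cast
    rw [h1]
    ring
  rw [← Real.norm_eq_abs, ← Complex.norm_real, h2, norm_mul]
  have h3 : ‖1 / (Fintype.card F : ℂ) ^ codim V‖ = 1 / (Fintype.card F : ℝ) ^ codim V := by
    simp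
  rw [h3]
  apply mul_le_mul_of_nonneg_left _ (by positivity)
  have h4 : (Finset.univ.erase (0 : orth V)) = ({v | v ≠ 0} : Finset (orth V)) := by
    ext v
    simp
  rw [h4]
  apply (norm_sum_le _ _).trans
  apply Finset.sum_le_sum
  intro v _
  rw [norm_mul, AddChar.norm_apply, mul_one, norm_prod]
  exact prod_norm_hat_le ψ hw _

/-- All Fourier coefficients of the lazy law are positive, so the exponential sum is bounded above
by a probability. This converts the right side of the Halász comparison back into the mass of `V`.
-/
lemma le_pr_lazy (hψ : ψ 1 ≠ 1) {w : Fin n → F → ℝ} (hw : ∀ j, IsWeight (w j)) {β : ℝ}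
    (hβ0 : 0 ≤ β) (hβ : β ≤ 1 / 2) (V : Submodule F (Fin n → F)) :
    1 / (Fintype.card F : ℝ) ^ codim V * ∑ v : orth V, Real.exp (-(2 * β * rowDefect ψ w v))
      ≤ pr (pw fun j => lazy β (w j)) V := by
  have h1 := pr_coset_eq ψ hψ (fun j => lazy β (w j)) V 0
  have h2 : pr (pw fun j => lazy β (w j)) V = 1 / (Fintype.card F : ℝ) ^ codim V *
      ∑ v : orth V, ∏ j, (1 - β * defect ψ (w j) ((v : Fin n → F) j)) := by
    have h3 : {y : Fin n → F | y - 0 ∈ V} = V := by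
      ext y
      simp
    rw [h3] at h1
    simp only [hat_lazy ψ (hw _), dotProduct_zero, neg_zero, AddChar.map_zero_eq_one,
      mul_one] at h1
    apply Complex.ofReal_injective
    rw [h1]
    push_cast
    rfl
  rw [h2]
  apply mul_le_mul_of_nonneg_left _ (by positivity)
  apply Finset.sum_le_sum
  intro v _
  rw [rowDefect, Finset.mul_sum, ← Finset.sum_neg_distrib, Real.exp_sum]
  apply Finset.prod_le_prod
  · intro j _
    exact (Real.exp_pos _).le
  · intro j _
    have g0 := (isSqNorm_defect ψ (hw j).nonneg).nonneg ((v : Fin n → F) j)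
    have g1 := defect_le_one ψ (hw j) ((v : Fin n → F) j)
    rw [mul_assoc]
    exact exp_le_one_sub_mul (mul_nonneg hβ0 g0) (by nlinarith)

/-- Averaging the total defect over a group of vectors whose support is large. -/
lemma le_sum_rowDefect (hψ : ψ 1 ≠ 1) {ι : Type*} [Fintype ι] {α : ℝ} {w : ι → F → ℝ}
    (hw : ∀ j, IsWeight (w j)) (hb : ∀ j, WBalanced α (w j))
    {H : Type*} [AddCommGroup H] [Fintype H] (θ : H →+ (ι → F)) (S : Finset ι)
    (hS : ∀ j ∈ S, ∃ h, θ h j ≠ 0) :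
    α * #S * Fintype.card H ≤ ∑ h, rowDefect ψ w (θ h) := by
  have h0 : ∀ j v, 0 ≤ defect ψ (w j) v := fun j => (isSqNorm_defect ψ (hw j).nonneg).nonneg
  simp only [rowDefect]
  rw [Finset.sum_comm]
  calc α * #S * Fintype.card H = ∑ j ∈ S, α * Fintype.card H := by
        rw [Finset.sum_const, nsmul_eq_mul]
        ring
    _ ≤ ∑ j ∈ S, ∑ h, defect ψ (w j) (θ h j) := by
        apply Finset.sum_le_sum
        intro j hj
        exact le_sum_defect ψ hψ (hw j) (hb j) ((Pi.evalAddMonoidHom (fun _ => F) j).comp θ)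
          (hS j hj)
    _ ≤ _ := Finset.sum_le_sum_of_subset_of_nonneg (Finset.subset_univ S) fun j _ _ =>
        Finset.sum_nonneg fun h _ => h0 j _

omit [Fintype F] in
lemma ncard_support (v : Fin n → F) : (Function.support v).ncard = #{j | v j ≠ 0} := by
  rw [← Set.ncard_coe_finset]
  congr 1
  ext j
  simp

/-- A nonzero `v ∈ H` has more than `δ n` nonzero coordinates, so the average of `rowDefect` over
`H` already exceeds `α δ n`. Arbitrary additive subgroups are needed here, since sumset growth
yields nothing better than a subgroup. -/
lemma exists_lt_rowDefect (hψ : ψ 1 ≠ 1) {α δ : ℝ} (hα : 0 < α) {w : Fin n → F → ℝ}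
    (hw : ∀ j, IsWeight (w j)) (hb : ∀ j, WBalanced α (w j)) {V : Submodule F (Fin n → F)}
    (hV : ¬ IsSparse δ V) (H : AddSubgroup (orth V)) (hH : H ≠ ⊥) :
    ∃ v ∈ H, α * δ * n < rowDefect ψ w v := by
  obtain ⟨⟨v, hv⟩, hv0'⟩ := AddSubgroup.ne_bot_iff_exists_ne_zero.1 hH
  have hv0 : v ≠ 0 := fun h => hv0' (Subtype.ext h)
  have hcard : δ * n < #{j | (v : Fin n → F) j ≠ 0} := by
    by_contra! hle
    apply hV
    refine ⟨v, fun h => hv0 (Subtype.ext h), mem_orth.1 v.2, ?_⟩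
    rw [ncard_support]
    exact hle
  have h1 := le_sum_rowDefect ψ hψ hw hb ((orth V).subtype.toAddMonoidHom.comp H.subtype)
    {j | (v : Fin n → F) j ≠ 0} (fun j hj => ⟨⟨v, hv⟩, by simpa using hj⟩)
  by_contra! hcon
  have hc : (0 : ℝ) < Fintype.card H := Nat.cast_pos.2 Fintype.card_pos
  have h2 : ∑ h : H, rowDefect ψ w (((orth V).subtype.toAddMonoidHom.comp H.subtype) h)
      ≤ ∑ h : H, α * δ * n := Finset.sum_le_sum fun h _ => hcon h.1 h.2
  rw [Finset.sum_const, Finset.card_univ, nsmul_eq_mul] at h2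
  have h3 : α * δ * n < α * #{j | (v : Fin n → F) j ≠ 0} := by
    rw [mul_assoc]
    exact mul_lt_mul_of_pos_left hcard hα
  nlinarith

/-- For non-sparse subspaces, the nonuniformity is much smaller than the mass of the lazy law. -/
lemma abs_pr_coset_sub_le_lazy (hψ : ψ 1 ≠ 1) {α δ : ℝ} (hα : 0 < α) (hδ : 0 ≤ δ)
    {w : Fin n → F → ℝ} (hw : ∀ j, IsWeight (w j)) (hb : ∀ j, WBalanced α (w j))
    {V : Submodule F (Fin n → F)} (hV : ¬ IsSparse δ V) (x : Fin n → F) (m : ℕ) (hm : 1 ≤ m) :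
    |pr (pw w) {y | y - x ∈ V} - 1 / (Fintype.card F : ℝ) ^ codim V|
      ≤ (1 / (m + 1) + Real.exp (-(α * δ * n / (4 * (3 * m + 1) ^ 2)))) *
        pr (pw fun j => lazy (1 / (4 * (3 * m + 1) ^ 2)) (w j)) V := by
  have hm' : (1 : ℝ) ≤ m := by exact_mod_cast hm
  have hf : IsSqNorm fun v : orth V => rowDefect ψ w v :=
    (isSqNorm_rowDefect ψ fun j => (hw j).nonneg).comp (orth V).subtype.toAddMonoidHom
  have h1 := hf.sum_exp_ne_zero_le (T := α * δ * n) (by positivity)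
    (exists_lt_rowDefect ψ hψ hα hw hb hV) m hm
  have hL : (2 : ℝ) ≤ 4 * (3 * m + 1) ^ 2 := by nlinarith
  -- This `β` makes `2 * β * f` equal to `f / (2 * (3 * m + 1) ^ 2)`, the coarser scale of `h1`.
  have h2 := le_pr_lazy ψ hψ hw (β := 1 / (4 * (3 * m + 1) ^ 2)) (by positivity)
    (one_div_le_one_div_of_le (by norm_num) hL) V
  apply (abs_pr_coset_sub_le ψ hψ hw V x).trans
  refine le_trans (mul_le_mul_of_nonneg_left
    (le_of_eq_of_le (Finset.sum_congr (by ext; simp) fun _ _ => rfl) h1) (by positivity)) ?_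
  rw [mul_left_comm]
  apply mul_le_mul_of_nonneg_left _ (by positivity)
  refine le_trans (le_of_eq ?_) h2
  congr 1
  apply Finset.sum_congr rfl
  intro v _
  congr 2
  field_simp
  ring

end Orth

/-! ### Union bound for sparse row spaces. -/

section Sparse

open Finset
open scoped Classical

/-- Vectors from a family extending a subspace `U` to its span with the family. -/
lemma exists_finset_sup_span_eq {K W ι : Type*} [Field K] [AddCommGroup W] [Module K W]
    [FiniteDimensional K W] [Fintype ι] (U : Submodule K W) (x : ι → W) :
    ∃ I : Finset ι, #I + Module.finrank K U ≤ Module.finrank K ↥(U ⊔ Submodule.span K (Set.range x))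
      ∧ U ⊔ Submodule.span K (x '' I) = U ⊔ Submodule.span K (Set.range x) := by
  suffices h : ∀ s : Finset ι, ∃ I : Finset ι,
      #I + Module.finrank K U ≤ Module.finrank K ↥(U ⊔ Submodule.span K (x '' s))
      ∧ U ⊔ Submodule.span K (x '' I) = U ⊔ Submodule.span K (x '' s) by
    have := h Finset.univ
    rwa [Finset.coe_univ, Set.image_univ] at this
  intro s
  induction s using Finset.induction_on with
  | empty => exact ⟨∅, by
    rw [Finset.card_empty, zero_add]
    exact Submodule.finrank_mono le_sup_left, rfl⟩
  | insert a s ha ih =>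
    obtain ⟨I, hI, hspan⟩ := ih
    have hins : U ⊔ Submodule.span K (x '' ↑(insert a s))
        = (U ⊔ Submodule.span K (x '' s)) ⊔ Submodule.span K {x a} := by
      rw [Finset.coe_insert, Set.image_insert_eq, Set.insert_eq, Submodule.span_union, sup_assoc,
        sup_comm (Submodule.span K {x a})]
    by_cases hxa : x a ∈ U ⊔ Submodule.span K (x '' s)
    · refine ⟨I, ?_, ?_⟩
      · rw [hins, sup_eq_left.2 ((Submodule.span_singleton_le_iff_mem _ _).2 hxa)]
        exact hI
      · rw [hins, sup_eq_left.2 ((Submodule.span_singleton_le_iff_mem _ _).2 hxa)]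
        exact hspan
    · refine ⟨insert a I, ?_, ?_⟩
      · have hlt : U ⊔ Submodule.span K (x '' s) < U ⊔ Submodule.span K (x '' ↑(insert a s)) := by
          rw [hins]
          refine lt_of_le_of_ne le_sup_left fun h => hxa ?_
          rw [h]
          exact Submodule.mem_sup_right (Submodule.mem_span_singleton_self _)
        have := Submodule.finrank_lt_finrank_of_lt hlt
        have := Finset.card_insert_le a I
        omega
      · rw [hins, ← hspan, Finset.coe_insert, Set.image_insert_eq, Set.insert_eq,
          Submodule.span_union, sup_assoc, sup_comm (Submodule.span K {x a})]

variable {F : Type*} [Field F] {n : ℕ}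

/-- The set of nonzero coordinates. -/
noncomputable def supp (v : Fin n → F) : Finset (Fin n) := {j | v j ≠ 0}

lemma mem_supp {v : Fin n → F} {j : Fin n} : j ∈ supp v ↔ v j ≠ 0 := by
  simp [supp]

lemma supp_eq_empty {v : Fin n → F} : supp v = ∅ ↔ v = 0 := by
  simp [supp, Finset.filter_eq_empty_iff, funext_iff]

variable [Fintype F]

/-- Given the other coordinates, the equation forces a single value at a coordinate where `v` is
nonzero, and atoms have mass at most `1 - α`. -/
lemma pr_dotProduct_eq_zero_le {α : ℝ} {w : Fin n → F → ℝ} (hw : ∀ j, IsWeight (w j))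
    (hb : ∀ j, WBalanced α (w j)) {v : Fin n → F} (hv : v ≠ 0) :
    pr (pw w) {y | v ⬝ᵥ y = 0} ≤ 1 - α := by
  obtain ⟨j, hj⟩ := Function.ne_iff.1 hv
  have hj : v j ≠ 0 := hj
  have h1 := pr_pw_split_le hw ({j}ᶜ : Finset (Fin n)) Set.univ
    (fun Z _ => {x | v j * x + ∑ i : ({j}ᶜ : Finset (Fin n)), v i * Z i = 0}) (1 - α) (by
      intro Z _ i hi
      have hi : i = j := by simpa using hi
      rw [hi]
      set c : F := ∑ i : ({j}ᶜ : Finset (Fin n)), v i * Z i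
      refine le_trans ?_ ((hb j).apply_le (-(v j)⁻¹ * c))
      have : {x : F | v j * x + c = 0} ⊆ {-(v j)⁻¹ * c} := by
        intro x hx
        rw [Set.mem_ofPred_eq] at hx
        rw [Set.mem_singleton_iff]
        field_simp
        linear_combination hx
      apply (pr_mono (hw j).nonneg this).trans
      simp [pr_eq_sum_ite])
  rw [compl_compl, Finset.card_singleton, pow_one, pr_univ, (IsWeight.pw fun i => hw _).sum_eq_one,
    one_mul] at h1
  refine le_trans (pr_mono (IsWeight.pw hw).nonneg ?_) h1
  intro y hy
  rw [Set.mem_ofPred_eq] at hy ⊢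
  refine ⟨Set.mem_univ _, fun i hi => ?_⟩
  have hi : i = j := by simpa using hi
  subst hi
  rw [Set.mem_ofPred_eq, Finset.sum_coe_sort _ (fun j => v j * y j), ← hy, dotProduct,
    ← Finset.add_sum_erase _ _ (Finset.mem_univ i)]
  congr 2
  ext
  simp

/-- The probability is the average over scalars `t` of the row's transform at `t • v`. The defect of
`t • v` averages at least `α * #(supp v) ≥ 10`, so `IsSqNorm.sum_exp_le` applies with scale `1/2`.
-/
lemma pr_dotProduct_eq_zero_le_of_large (ψ : AddChar F ℂ) (hψ : ψ 1 ≠ 1) {α : ℝ}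
    {w : Fin n → F → ℝ} (hw : ∀ j, IsWeight (w j)) (hb : ∀ j, WBalanced α (w j)) {v : Fin n → F}
    (hv : 10 ≤ α * #(supp v)) : pr (pw w) {y | v ⬝ᵥ y = 0} ≤ 7 / 10 := by
  have hprim : ψ.IsPrimitive := AddChar.IsPrimitive.of_ne_one fun h => hψ (by simp [h])
  have hq : (0 : ℝ) < Fintype.card F := Nat.cast_pos.2 Fintype.card_pos
  have h1 : ((Fintype.card F * pr (pw w) {y | v ⬝ᵥ y = 0} : ℝ) : ℂ)
      = ∑ t : F, ∏ j, hat ψ (w j) (t * v j) := by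
    have : ∀ t : F, ∏ j, hat ψ (w j) (t * v j) = ∑ y, (pw w y : ℂ) * ψ (t * (v ⬝ᵥ y)) := by
      intro t
      have e : ∀ y : Fin n → F, t * (v ⬝ᵥ y) = (t • v) ⬝ᵥ y := fun y => by
        rw [smul_dotProduct, smul_eq_mul]
      simp only [e]
      exact prod_hat ψ w (t • v)
    simp only [this]
    rw [Finset.sum_comm, pr_eq_sum_ite, Finset.mul_sum]
    push_cast
    apply Finset.sum_congr rfl
    intro y _
    rw [← Finset.mul_sum, AddChar.sum_mulShift _ hprim]
    by_cases hy : v ⬝ᵥ y = 0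
    · simp [hy, mul_comm]
    · simp [hy]
  let θ : F →+ (Fin n → F) := AddMonoidHom.mk' (fun t => t • v) fun a b => add_smul a b v
  have h2 : Fintype.card F * pr (pw w) {y | v ⬝ᵥ y = 0}
      ≤ ∑ t : F, Real.exp (-(1 / 2 * rowDefect ψ w (θ t))) := by
    rw [← abs_of_nonneg (a := Fintype.card F * pr (pw w) {y | v ⬝ᵥ y = 0})
      (mul_nonneg hq.le (pr_nonneg (IsWeight.pw hw).nonneg _)), ← Real.norm_eq_abs,
      ← Complex.norm_real, h1]
    apply (norm_sum_le _ _).trans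
    apply Finset.sum_le_sum
    intro t _
    rw [norm_prod]
    refine (prod_norm_hat_le ψ hw (t • v)).trans (le_of_eq ?_)
    congr 2
    rw [mul_comm, mul_one_div]
    rfl
  have h3 := ((isSqNorm_rowDefect ψ fun j => (hw j).nonneg).comp θ).sum_exp_le
    (a := α * #(supp v)) (s := 1 / 2) (by linarith) (by norm_num) (by linarith)
    (le_sum_rowDefect ψ hψ hw hb θ (supp v) fun j hj => ⟨1, by
      simpa [θ] using mem_supp.1 hj⟩)
  have h4 := h2.trans h3
  rw [mul_comm] at h4
  exact le_of_mul_le_mul_right h4 hq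

variable {κ : Type*} [Fintype κ]

omit [Fintype F] in
/-- A sparse row space comes with a support `S` and fewer than `#S` rows that determine the
orthogonal vector supported on `S`. -/
lemma exists_support_of_isSparse {δ : ℝ} {X : κ → Fin n → F}
    (h : IsSparse δ (Submodule.span F (Set.range X))) :
    ∃ (S : Finset (Fin n)) (I : Finset κ) (v : Fin n → F), (#S : ℝ) ≤ δ * n ∧ #I < #S ∧
      supp v = S ∧ (∀ i ∈ I, v ⬝ᵥ X i = 0) ∧
      (∀ u, supp u ⊆ S → (∀ i ∈ I, u ⬝ᵥ X i = 0) → ∃ c : F, u = c • v) ∧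
      ∀ i, ∀ u, supp u ⊆ S → (∀ i ∈ I, u ⬝ᵥ X i = 0) → u ⬝ᵥ X i = 0 := by
  have hex : ∃ s : ℕ, ∃ v : Fin n → F, v ≠ 0 ∧ (∀ i, v ⬝ᵥ X i = 0) ∧ #(supp v) = s := by
    obtain ⟨v, hv, hvX, -⟩ := h
    exact ⟨_, v, hv, fun i => hvX _ (Submodule.subset_span ⟨i, rfl⟩), rfl⟩
  -- `v` has the smallest support among nonzero vectors orthogonal to every row.
  obtain ⟨v, hv, hvX, hvs⟩ := Nat.find_spec hex
  have hmin : ∀ u : Fin n → F, (∀ i, u ⬝ᵥ X i = 0) → #(supp u) < #(supp v) → u = 0 := by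
    intro u hu hlt
    by_contra hu0
    rw [hvs] at hlt
    exact Nat.find_min hex hlt ⟨u, hu0, hu, rfl⟩
  have hS : (#(supp v) : ℝ) ≤ δ * n := by
    obtain ⟨u, hu, huX, hus⟩ := h
    rw [ncard_support] at hus
    refine le_trans ?_ hus
    have : #(supp v) ≤ #(supp u) := by
      by_contra! hlt
      exact hu (hmin u (fun i => huX _ (Submodule.subset_span ⟨i, rfl⟩)) hlt)
    exact_mod_cast this
  -- Working modulo `U` amounts to restricting rows to the coordinates in `supp v`. The rows in `I`
  -- span the restricted row space, which lies in the hyperplane orthogonal to `v`; this gives the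
  -- strict inequality `#I < #(supp v)`.
  let U : Submodule F (Fin n → F) := ⨅ j ∈ supp v, LinearMap.ker (LinearMap.proj j)
  have hU : ∀ y, y ∈ U ↔ ∀ j ∈ supp v, y j = 0 := by
    intro y
    simp [U]
  have hUd : n ≤ Module.finrank F U + #(supp v) := by
    let R : (Fin n → F) →ₗ[F] (supp v → F) := LinearMap.funLeft F F Subtype.val
    have hR : LinearMap.ker R = U := by
      ext y
      rw [hU, LinearMap.mem_ker, funext_iff]
      simp [R, LinearMap.funLeft]
    have h1 := LinearMap.finrank_range_add_finrank_ker R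
    have h2 := Submodule.finrank_le (LinearMap.range R)
    rw [hR] at h1
    simp only [Module.finrank_fintype_fun_eq_card, Fintype.card_coe, Fintype.card_fin]
      at h1 h2
    omega
  obtain ⟨I, hI, hspan⟩ := exists_finset_sup_span_eq U X
  have hkill : ∀ u, supp u ⊆ supp v → (∀ i ∈ I, u ⬝ᵥ X i = 0) → ∀ i, u ⬝ᵥ X i = 0 := by
    intro u hu huI i
    have hmem : X i ∈ U ⊔ Submodule.span F (X '' I) := by
      rw [hspan]
      exact Submodule.mem_sup_right (Submodule.subset_span ⟨i, rfl⟩)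
    have hle : U ⊔ Submodule.span F (X '' I) ≤ LinearMap.ker (dotProductEquiv F (Fin n) u) := by
      rw [sup_le_iff, Submodule.span_le]
      constructor
      · intro y hy
        rw [LinearMap.mem_ker]
        change u ⬝ᵥ y = 0
        apply Finset.sum_eq_zero
        intro j _
        by_cases hj : u j = 0
        · rw [hj, zero_mul]
        · rw [(hU y).1 hy j (hu (mem_supp.2 hj)), mul_zero]
      · rintro _ ⟨i, hi, rfl⟩
        exact huI i hi
    exact hle hmem
  have hcard : #I < #(supp v) := by
    have hle : U ⊔ Submodule.span F (Set.range X)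
        ≤ LinearMap.ker (dotProductEquiv F (Fin n) v) := by
      rw [sup_le_iff, Submodule.span_le]
      constructor
      · intro y hy
        rw [LinearMap.mem_ker]
        change v ⬝ᵥ y = 0
        apply Finset.sum_eq_zero
        intro j _
        by_cases hj : v j = 0
        · rw [hj, zero_mul]
        · rw [(hU y).1 hy j (mem_supp.2 hj), mul_zero]
      · rintro _ ⟨i, rfl⟩
        exact hvX i
    have hlt : LinearMap.ker (dotProductEquiv F (Fin n) v) < ⊤ := by
      rw [lt_top_iff_ne_top, Ne, LinearMap.ker_eq_top]
      intro h0
      exact hv ((dotProductEquiv F (Fin n)).map_eq_zero_iff.1 h0)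
    have h1 := Submodule.finrank_lt_finrank_of_lt hlt
    rw [finrank_top, Module.finrank_fin_fun] at h1
    have h2 := Submodule.finrank_mono hle
    omega
  refine ⟨supp v, I, v, hS, hcard, rfl, fun i _ => hvX i, ?_, fun i u hu huI => hkill u hu huI i⟩
  intro u hu huI
  obtain ⟨j, hj⟩ := Function.ne_iff.1 hv
  have hj : v j ≠ 0 := hj
  -- Subtracting this multiple of `v` kills coordinate `j`, so minimality of the support forces the
  -- difference to vanish.
  refine ⟨u j / v j, sub_eq_zero.1 (hmin _ ?_ ?_)⟩
  · intro i
    rw [sub_dotProduct, smul_dotProduct, hkill u hu huI i, hvX i, smul_zero, sub_zero]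
  · apply Finset.card_lt_card
    refine (Finset.ssubset_iff_of_subset ?_).2 ⟨j, mem_supp.2 hj, ?_⟩
    · intro i hi
      rw [mem_supp] at hi ⊢
      intro h0
      apply hi
      have : u i = 0 := by
        by_contra hui
        exact mem_supp.1 (hu (mem_supp.2 hui)) h0
      simp [h0, this]
    · rw [mem_supp, not_not]
      simp [hj]

/-- Union bound for sparse row spaces. -/
lemma pr_isSparse_le_sum [DecidableEq κ] {δ : ℝ} {p : κ → (Fin n → F) → ℝ} (hp : ∀ i, IsWeight (p i)) (b : ℕ → ℝ)
    (hb0 : ∀ s, 0 ≤ b s)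
    (hb : ∀ i, ∀ v : Fin n → F, v ≠ 0 → pr (p i) {y | v ⬝ᵥ y = 0} ≤ b #(supp v)) :
    pr (pw p) {X | IsSparse δ (Submodule.span F (Set.range X))}
      ≤ ∑ S : Finset (Fin n) with (#S : ℝ) ≤ δ * n, ∑ I : Finset κ with #I < #S,
        b #S ^ (#Iᶜ) := by
  rw [Finset.sum_sigma']
  -- The existence of `v` is a condition on the rows in `I` alone. Once they are fixed, any one such
  -- `v` bounds all the remaining rows, so no sum over `v` occurs.
  let E : (Σ _ : Finset (Fin n), Finset κ) → Set (κ → Fin n → F) := fun q =>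
    {X | (fun i : q.2 => X i) ∈ {Z : q.2 → Fin n → F | ∃ v, supp v = q.1 ∧
        (∀ i, v ⬝ᵥ Z i = 0) ∧ q.1.Nonempty} ∧
      ∀ i ∉ q.2, X i ∈ (fun Z : q.2 → Fin n → F =>
        {y | ∀ u, supp u ⊆ q.1 → (∀ i, u ⬝ᵥ Z i = 0) → u ⬝ᵥ y = 0}) fun i : q.2 => X i}
  refine (pr_le_sum_pr (IsWeight.pw hp).nonneg _ E ?_).trans (Finset.sum_le_sum ?_)
  · intro X hX
    obtain ⟨S, I, v, hS, hI, hvS, hvI, -, hrest⟩ := exists_support_of_isSparse hX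
    refine ⟨⟨S, I⟩, by simp [hS, hI], ⟨v, hvS, fun i => hvI i i.2,
      Finset.card_pos.1 ((Nat.zero_le _).trans_lt hI)⟩, ?_⟩
    · intro i _ u hu huI
      exact hrest i u hu fun i hi => huI ⟨i, hi⟩
  · rintro ⟨S, I⟩ _
    have h1 := pr_pw_split_le hp I {Z : I → Fin n → F | ∃ v, supp v = S ∧
        (∀ i, v ⬝ᵥ Z i = 0) ∧ S.Nonempty}
      (fun Z _ => {y | ∀ u, supp u ⊆ S → (∀ i, u ⬝ᵥ Z i = 0) → u ⬝ᵥ y = 0}) (b #S) (by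
        rintro Z ⟨v, hvS, hvZ, hS⟩ i _
        have hv : v ≠ 0 := by
          intro h0
          rw [← hvS, supp_eq_empty.2 h0] at hS
          exact Finset.not_nonempty_empty hS
        rw [← hvS]
        refine (pr_mono (hp i).nonneg ?_).trans (hb i v hv)
        intro y hy
        exact hy v (by rw [hvS]) hvZ)
    refine h1.trans ?_
    exact mul_le_of_le_one_left (pow_nonneg (hb0 _) _)
      ((IsWeight.pw fun i => hp _).pr_le_one _)

end Sparse

/-! ### Numerical bound for the sparse case. -/

section SparseBound

open Finset
open scoped Classical

/-- Rankin's trick: each counted set contributes at least `x ^ t` to the generating function `∑ x ^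
#S = (1 + x) ^ N`. -/
lemma card_filter_card_le {ι : Type*} [Fintype ι] {x t : ℝ} (hx : 0 < x) (hx1 : x ≤ 1) :
    (#{S : Finset ι | (#S : ℝ) ≤ t} : ℝ) ≤ (1 + x) ^ Fintype.card ι * x ^ (-t) := by
  have h1 : (1 + x) ^ Fintype.card ι = ∑ S : Finset ι, x ^ #S := by
    rw [add_comm, ← Fintype.sum_pow_mul_eq_add_pow]
    simp
  have h2 : (#{S : Finset ι | (#S : ℝ) ≤ t} : ℝ) * x ^ t ≤ ∑ S : Finset ι, x ^ #S := by
    rw [← nsmul_eq_mul]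
    refine (Finset.card_nsmul_le_sum _ (fun S : Finset ι => x ^ #S) _ ?_).trans
      (Finset.sum_le_sum_of_subset_of_nonneg (Finset.subset_univ _) fun S _ _ => by positivity)
    intro S hS
    rw [← Real.rpow_natCast]
    exact Real.rpow_le_rpow_of_exponent_ge hx hx1 (by simpa using hS)
  rw [Real.rpow_neg hx.le, ← div_eq_mul_inv, le_div_iff₀ (Real.rpow_pos_of_pos hx t), h1]
  exact h2

lemma card_filter_card_le_exp {ι : Type*} [Fintype ι] {n : ℕ} (hι : Fintype.card ι ≤ n) {δ : ℝ}
    (hδ : δ ≤ 1 / 100) :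
    (#{S : Finset ι | (#S : ℝ) ≤ δ * n} : ℝ) ≤ Real.exp (8 / 100 * n) := by
  have hn : (0 : ℝ) ≤ n := Nat.cast_nonneg n
  have h1 := card_filter_card_le (ι := ι) (x := 1 / 20) (t := 1 / 100 * n) (by norm_num)
    (by norm_num)
  have h20 : (20 : ℝ) ≤ Real.exp 3 := by
    have h2 := Real.exp_one_gt_d9
    have h3 : Real.exp 3 = Real.exp 1 ^ 3 := by
      rw [← Real.exp_nat_mul]
      norm_num
    rw [h3]
    calc (20 : ℝ) ≤ 2.7182818283 ^ 3 := by norm_num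
      _ ≤ _ := pow_le_pow_left₀ (by norm_num) h2.le 3
  have h2 : (1 / 20 : ℝ) ^ (-(1 / 100 * n : ℝ)) ≤ Real.exp (3 / 100 * n) := by
    rw [one_div, Real.inv_rpow (by norm_num), Real.rpow_neg (by norm_num), inv_inv]
    calc (20 : ℝ) ^ (1 / 100 * n : ℝ) ≤ Real.exp 3 ^ (1 / 100 * n : ℝ) :=
          Real.rpow_le_rpow (by norm_num) h20 (by positivity)
      _ = _ := by
        rw [← Real.exp_mul]
        congr 1
        ring
  have h3 : (1 + 1 / 20 : ℝ) ^ Fintype.card ι ≤ Real.exp (5 / 100 * n) := by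
    calc (1 + 1 / 20 : ℝ) ^ Fintype.card ι ≤ (1 + 1 / 20 : ℝ) ^ n :=
          pow_le_pow_right₀ (by norm_num) hι
      _ ≤ Real.exp (1 / 20) ^ n := by
          apply pow_le_pow_left₀ (by norm_num)
          have := Real.add_one_le_exp (1 / 20)
          linarith
      _ = _ := by
        rw [← Real.exp_nat_mul]
        congr 1
        ring
  calc (#{S : Finset ι | (#S : ℝ) ≤ δ * n} : ℝ) ≤ #{S : Finset ι | (#S : ℝ) ≤ 1 / 100 * n} := by
        refine Nat.cast_le.2 (Finset.card_le_card ?_)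
        intro S hS
        simp only [Finset.mem_filter, Finset.mem_univ, true_and] at hS ⊢
        exact hS.trans (mul_le_mul_of_nonneg_right hδ hn)
    _ ≤ _ := h1
    _ ≤ Real.exp (5 / 100 * n) * Real.exp (3 / 100 * n) := by gcongr
    _ = _ := by
      rw [← Real.exp_add]
      congr 1
      ring

lemma card_filter_card_le_rpow {ι : Type*} [Fintype ι] {n : ℕ} (hι : Fintype.card ι ≤ n)
    (hn : 1 ≤ n) (t : ℝ) :
    (#{S : Finset ι | (#S : ℝ) ≤ t} : ℝ) ≤ Real.exp 1 * (n : ℝ) ^ t := by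
  have hn' : (1 : ℝ) ≤ n := by exact_mod_cast hn
  have hn0 : (0 : ℝ) < n := by linarith
  have h1 := card_filter_card_le (ι := ι) (x := 1 / n) (t := t) (by positivity)
    (by rw [div_le_one hn0]; exact hn')
  have h3 : (1 + 1 / n : ℝ) ^ Fintype.card ι ≤ Real.exp 1 := by
    calc (1 + 1 / n : ℝ) ^ Fintype.card ι ≤ (1 + 1 / n : ℝ) ^ n :=
          pow_le_pow_right₀ (by simp) hι
      _ ≤ Real.exp (1 / n) ^ n := by
          apply pow_le_pow_left₀ (by positivity)
          have := Real.add_one_le_exp (1 / n : ℝ)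
          linarith
      _ = _ := by
        rw [← Real.exp_nat_mul]
        congr 1
        field_simp
  refine h1.trans ?_
  rw [one_div, Real.inv_rpow hn0.le, Real.rpow_neg hn0.le, inv_inv, ← one_div]
  gcongr

variable {F : Type*} [Field F] {n : ℕ} [Fintype F]

/-- The probability that the row space is sparse. -/
lemma pr_isSparse_le (ψ : AddChar F ℂ) (hψ : ψ 1 ≠ 1) {α δ : ℝ} (hα : 0 < α) (hδ : δ ≤ 1 / 100)
    (hn : 1 ≤ n) {k : ℕ} (hk : k ≤ n) (hk' : 9 / 10 * (n : ℝ) ≤ k) {w : Fin k → Fin n → F → ℝ}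
    (hw : ∀ i j, IsWeight (w i j)) (hb : ∀ i j, WBalanced α (w i j)) :
    pr (pw fun i => pw (w i)) {X | IsSparse δ (Submodule.span F (Set.range X))}
      ≤ Real.exp (-(n / 10)) + (Real.exp 1 * (n : ℝ) ^ (10 / α)) ^ 2 *
        Real.exp (-(89 / 100 * α * n)) := by
  have hn0 : (0 : ℝ) ≤ n := Nat.cast_nonneg n
  -- Decay rate per row. Large supports get an absolute rate, enough to beat exponentially many
  -- pairs `(S, I)`. Supports smaller than `10 / α` get only `α`, but there are only polynomially
  -- many such pairs.
  let B : ℕ → ℝ := fun s => if 10 ≤ α * s then 1 / 3 else α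
  have hB0 : ∀ s, 0 ≤ B s := by
    intro s
    simp only [B]
    split_ifs
    · norm_num
    · exact hα.le
  have h710 : (7 / 10 : ℝ) ≤ Real.exp (-(1 / 3)) := by
    have h1 : (7 / 10 : ℝ) ^ 3 ≤ Real.exp (-(1 / 3)) ^ 3 := by
      rw [← Real.exp_nat_mul]
      have := Real.exp_neg_one_gt_d9
      norm_num
      linarith
    exact le_of_pow_le_pow_left₀ (by norm_num) (Real.exp_pos _).le h1
  have hmain := pr_isSparse_le_sum (δ := δ) (p := fun i => pw (w i)) (fun i => IsWeight.pw (hw i))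
    (fun s => Real.exp (-B s)) (fun s => (Real.exp_pos _).le) (by
      intro i v hv
      simp only [B]
      split_ifs with h
      · exact (pr_dotProduct_eq_zero_le_of_large ψ hψ (hw i) (hb i) h).trans h710
      · refine (pr_dotProduct_eq_zero_le (hw i) (hb i) hv).trans ?_
        have := Real.add_one_le_exp (-α)
        linarith)
  refine hmain.trans ?_
  set T : Finset (Finset (Fin n)) := {S | (#S : ℝ) ≤ δ * n}
  set T' : Finset (Finset (Fin k)) := {S | (#S : ℝ) ≤ δ * n}
  set R : Finset (Finset (Fin n)) := {S | (#S : ℝ) ≤ 10 / α}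
  set R' : Finset (Finset (Fin k)) := {S | (#S : ℝ) ≤ 10 / α}
  have hterm : ∀ S : Finset (Fin n), ∀ I : Finset (Fin k), (#S : ℝ) ≤ δ * n → #I < #S →
      Real.exp (-B #S) ^ #Iᶜ ≤ Real.exp (-(B #S * (89 / 100 * n))) := by
    intro S I hS hI
    rw [← Real.exp_nat_mul, Real.exp_le_exp]
    have h1 : (#Iᶜ : ℝ) = k - #I := by
      rw [Finset.card_compl, Fintype.card_fin, Nat.cast_sub]
      simpa using Finset.card_le_univ I
    have h2 : (#I : ℝ) ≤ #S := by exact_mod_cast hI.le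
    have h3 : δ * n ≤ 1 / 100 * n := mul_le_mul_of_nonneg_right hδ hn0
    have h4 : 89 / 100 * (n : ℝ) ≤ #Iᶜ := by linarith
    have := mul_le_mul_of_nonneg_left h4 (hB0 #S)
    linarith
  calc ∑ S ∈ T, ∑ I : Finset (Fin k) with #I < #S, Real.exp (-B #S) ^ #Iᶜ
      ≤ ∑ S ∈ T, ∑ I : Finset (Fin k) with #I < #S,
        ((if S ∈ T ∧ I ∈ T' then Real.exp (-(1 / 3 * (89 / 100 * n))) else 0)
          + (if S ∈ R ∧ I ∈ R' then Real.exp (-(α * (89 / 100 * n))) else 0)) := by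
        apply Finset.sum_le_sum
        intro S hS
        apply Finset.sum_le_sum
        intro I hI
        have hS' : (#S : ℝ) ≤ δ * n := by simpa [T] using hS
        have hI' : #I < #S := by simpa using hI
        have hIS : (#I : ℝ) ≤ #S := by exact_mod_cast hI'.le
        refine (hterm S I hS' hI').trans ?_
        by_cases h : 10 ≤ α * #S
        · have hIT : I ∈ T' := by simpa [T'] using hIS.trans hS'
          rw [if_pos ⟨hS, hIT⟩]
          have : B #S = 1 / 3 := if_pos h
          rw [this]
          apply le_add_of_nonneg_right
          split_ifs
          · positivity
          · exact le_rfl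
        · have hSR : (#S : ℝ) ≤ 10 / α := by
            rw [le_div_iff₀ hα]
            linarith
          have hSR' : S ∈ R := by simpa [R] using hSR
          have hIR : I ∈ R' := by simpa [R'] using hIS.trans hSR
          rw [if_pos (⟨hSR', hIR⟩ : S ∈ R ∧ I ∈ R')]
          have : B #S = α := if_neg h
          rw [this]
          apply le_add_of_nonneg_left
          split_ifs
          · positivity
          · exact le_rfl
    _ ≤ ∑ S : Finset (Fin n), ∑ I : Finset (Fin k),
        ((if S ∈ T ∧ I ∈ T' then Real.exp (-(1 / 3 * (89 / 100 * n))) else 0)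
          + (if S ∈ R ∧ I ∈ R' then Real.exp (-(α * (89 / 100 * n))) else 0)) := by
        have hnn : ∀ (S : Finset (Fin n)) (I : Finset (Fin k)), 0 ≤
            ((if S ∈ T ∧ I ∈ T' then Real.exp (-(1 / 3 * (89 / 100 * n))) else 0)
          + (if S ∈ R ∧ I ∈ R' then Real.exp (-(α * (89 / 100 * n))) else 0)) := by
          intro S I
          have := Real.exp_pos (-(1 / 3 * (89 / 100 * n)))
          have := Real.exp_pos (-(α * (89 / 100 * n)))
          split_ifs <;> linarith
        refine (Finset.sum_le_sum fun S _ => Finset.sum_le_sum_of_subset_of_nonneg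
          (Finset.subset_univ _) fun I _ _ => hnn S I).trans ?_
        exact Finset.sum_le_sum_of_subset_of_nonneg (Finset.subset_univ _) fun S _ _ =>
          Finset.sum_nonneg fun I _ => hnn S I
    _ = #T * #T' * Real.exp (-(1 / 3 * (89 / 100 * n)))
        + #R * #R' * Real.exp (-(α * (89 / 100 * n))) := by
        have hcount : ∀ (A : Finset (Finset (Fin n))) (A' : Finset (Finset (Fin k))) (c : ℝ),
            ∑ S : Finset (Fin n), ∑ I : Finset (Fin k), (if S ∈ A ∧ I ∈ A' then c else 0)
            = #A * #A' * c := by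
          intro A A' c
          simp only [ite_and]
          have : ∀ S : Finset (Fin n), ∑ I : Finset (Fin k),
              (if S ∈ A then if I ∈ A' then c else 0 else 0) = if S ∈ A then #A' * c else 0 := by
            intro S
            split_ifs
            · simp
            · simp
          simp only [this]
          simp [mul_assoc]
        simp only [Finset.sum_add_distrib]
        rw [hcount, hcount]
    _ ≤ Real.exp (8 / 100 * n) * Real.exp (8 / 100 * n) * Real.exp (-(1 / 3 * (89 / 100 * n)))
        + (Real.exp 1 * (n : ℝ) ^ (10 / α)) * (Real.exp 1 * (n : ℝ) ^ (10 / α)) *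
          Real.exp (-(α * (89 / 100 * n))) := by
        have t1 := card_filter_card_le_exp (ι := Fin n) (n := n) (by simp) hδ
        have t2 := card_filter_card_le_exp (ι := Fin k) (n := n) (by simpa using hk) hδ
        have t3 := card_filter_card_le_rpow (ι := Fin n) (n := n) (by simp) hn (10 / α)
        have t4 := card_filter_card_le_rpow (ι := Fin k) (n := n) (by simpa using hk) hn (10 / α)
        gcongr
    _ ≤ _ := by
        apply add_le_add
        · rw [← Real.exp_add, ← Real.exp_add, Real.exp_le_exp]
          linarith
        · rw [← pow_two]
          refine le_of_eq ?_
          congr 2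
          ring

end SparseBound

/-! ### Swapping rows for lazy samples. -/

section Swap

open Finset
open scoped Classical

variable {F : Type*} [Field F] [Fintype F] {n : ℕ}

/-- A product law with small atoms gives small mass to subspaces of large codimension. -/
lemma pr_subspace_le_pow_codim {ν : Fin n → F → ℝ} (hν : ∀ j, IsWeight (ν j)) {b : ℝ}
    (hb : ∀ j x, ν j x ≤ b) (U : Submodule F (Fin n → F)) :
    pr (pw ν) U ≤ b ^ codim U := by
  -- The unit vectors indexed by `I` span a complement of `U`. A point of `U` is then determined by
  -- its coordinates outside `I`, and each of the `codim U` coordinates in `I` must hit one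
  -- prescribed value.
  obtain ⟨I, hI, hspan⟩ := exists_finset_sup_span_eq U (fun j : Fin n => (Pi.single j 1 : Fin n → F))
  have htop : Submodule.span F (Set.range fun j : Fin n => (Pi.single j 1 : Fin n → F)) = ⊤ := by
    have := (Pi.basisFun F (Fin n)).span_eq
    rw [← this]
    congr 1
    ext
    simp
  rw [htop, sup_top_eq] at hspan
  rw [htop, sup_top_eq, finrank_top, Module.finrank_fin_fun] at hI
  set D := Submodule.span F ((fun j : Fin n => (Pi.single j 1 : Fin n → F)) '' I) with hD
  have hDle : Module.finrank F D ≤ #I := by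
    have h1 := finrank_span_finset_le_card (R := F)
      (I.image (fun j : Fin n => (Pi.single j 1 : Fin n → F)))
    rw [Finset.coe_image] at h1
    exact h1.trans Finset.card_image_le
  have hdim := Submodule.finrank_sup_add_finrank_inf_eq U D
  rw [hspan, finrank_top, Module.finrank_fin_fun] at hdim
  have hcod := finrank_add_codim U
  have hcard : #I = codim U := by omega
  have hinf : U ⊓ D = ⊥ := by
    apply Submodule.finrank_eq_zero.1
    omega
  have huniq : ∀ y ∈ U, ∀ y' ∈ U, (∀ j ∉ I, y j = y' j) → y = y' := by
    intro y hy y' hy' h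
    have hmem : y - y' ∈ U ⊓ D := by
      refine ⟨U.sub_mem hy hy', ?_⟩
      rw [pi_eq_sum_univ (y - y')]
      apply Submodule.sum_mem
      intro j _
      by_cases hj : j ∈ I
      · apply Submodule.smul_mem
        apply Submodule.subset_span
        refine ⟨j, hj, ?_⟩
        ext i
        simp [Pi.single_apply, eq_comm]
      · simp [h j hj]
    rw [hinf, Submodule.mem_bot] at hmem
    exact sub_eq_zero.1 hmem
  have h1 := pr_pw_split_le hν Iᶜ Set.univ
    (fun Z i => {x | ∃ y ∈ U, (∀ j : (Iᶜ : Finset (Fin n)), y j = Z j) ∧ y i = x}) b (by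
      intro Z _ i _
      by_cases hex : ∃ y ∈ U, ∀ j : (Iᶜ : Finset (Fin n)), y j = Z j
      · obtain ⟨y, hy, hyZ⟩ := hex
        refine le_trans (pr_mono (hν i).nonneg (T := {y i}) ?_) (le_trans ?_ (hb i (y i)))
        · rintro x ⟨y', hy', hyZ', rfl⟩
          rw [Set.mem_singleton_iff, huniq y' hy' y hy]
          intro j hj
          have hj' : j ∈ Iᶜ := by simpa using hj
          rw [hyZ' ⟨j, hj'⟩, hyZ ⟨j, hj'⟩]
        · simp [pr_eq_sum_ite]
      · have : {x : F | ∃ y ∈ U, (∀ j : (Iᶜ : Finset (Fin n)), y j = Z j) ∧ y i = x} = ∅ := by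
          ext x
          simp only [Set.mem_ofPred_eq, Set.mem_empty_iff_false, iff_false]
          rintro ⟨y, hy, hyZ, -⟩
          exact hex ⟨y, hy, hyZ⟩
        rw [this]
        have hb0 : 0 ≤ b := ((hν i).nonneg 0).trans (hb i 0)
        simpa [pr_eq_sum_ite] using hb0)
  rw [compl_compl, pr_univ, (IsWeight.pw fun i => hν _).sum_eq_one, one_mul, hcard] at h1
  refine le_trans (pr_mono (IsWeight.pw hν).nonneg ?_) h1
  intro y hy
  exact ⟨Set.mem_univ _, fun i _ => ⟨y, hy, fun j => rfl, rfl⟩⟩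

/-- Independent samples from a law that charges `V` much more than small subspaces are often
linearly independent vectors of `V`. -/
lemma le_pr_linearIndependent {ν : (Fin n → F) → ℝ} (hν : IsWeight ν)
    (V : Submodule F (Fin n → F)) {u : ℝ} (R : ℕ)
    (hu : ∀ U : Submodule F (Fin n → F), Module.finrank F U < R → pr ν U ≤ u)
    (huV : u ≤ pr ν V) (r : ℕ) (hr : r ≤ R) :
    (pr ν V - u) ^ r ≤
      pr (pw fun _ : Fin r => ν) {Y | (∀ i, Y i ∈ V) ∧ LinearIndependent F Y} := by
  induction r with
  | zero =>
    have h : {Y : Fin 0 → Fin n → F | (∀ i, Y i ∈ V) ∧ LinearIndependent F Y} = Set.univ := by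
      ext Y
      simp
    rw [h, pr_univ, (IsWeight.pw fun _ => hν).sum_eq_one, pow_zero]
  | succ r ih =>
    have h1 : pr (pw fun _ : Fin (r + 1) => ν) {Y | (∀ i, Y i ∈ V) ∧ LinearIndependent F Y}
        = ∑ Y : Fin r → Fin n → F, if (∀ i, Y i ∈ V) ∧ LinearIndependent F Y then
          pw (fun _ : Fin r => ν) Y *
            pr ν {x | x ∈ V ∧ x ∉ Submodule.span F (Set.range Y)} else 0 := by
      have h0 : ∀ (x : Fin n → F) (Y : Fin r → Fin n → F),
          LinearIndependent F (Fin.consEquiv (fun _ => (Fin n → F)) (x, Y))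
          ↔ LinearIndependent F Y ∧ x ∉ Submodule.span F (Set.range Y) := fun x Y =>
        linearIndependent_finCons
      rw [pr_eq_sum_ite, ← (Fin.consEquiv fun _ => (Fin n → F)).sum_comp, Fintype.sum_prod_type,
        Finset.sum_comm]
      apply Finset.sum_congr rfl
      intro Y _
      simp only [Fin.consEquiv_apply, Set.mem_ofPred_eq, Fin.forall_fin_succ, Fin.cons_zero,
        Fin.cons_succ, h0, pw, Fin.prod_univ_succ, pr_eq_sum_ite]
      split_ifs with h
      · rw [Finset.mul_sum]
        apply Finset.sum_congr rfl
        intro x _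
        by_cases hx : x ∈ V ∧ x ∉ Submodule.span F (Set.range Y)
        · rw [if_pos hx, if_pos ⟨⟨hx.1, h.1⟩, h.2, hx.2⟩, mul_comm]
        · rw [if_neg hx, if_neg fun hh => hx ⟨hh.1.1, hh.2.2⟩, mul_zero]
      · apply Finset.sum_eq_zero
        intro x _
        rw [if_neg fun hh => h ⟨hh.1.2, hh.2.1⟩]
    -- The span of the first `r` samples has dimension `r < R`, so it removes at most `u` from the
    -- mass of `V`.
    have h2 : ∀ Y : Fin r → Fin n → F, LinearIndependent F Y →
        pr ν V - u ≤ pr ν {x | x ∈ V ∧ x ∉ Submodule.span F (Set.range Y)} := by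
      intro Y hY
      have h3 := hu (Submodule.span F (Set.range Y)) (by
        rw [finrank_span_eq_card hY, Fintype.card_fin]
        omega)
      have h4 : (V : Set (Fin n → F)) ⊆ {x | x ∈ V ∧ x ∉ Submodule.span F (Set.range Y)}
          ∪ (Submodule.span F (Set.range Y) : Set (Fin n → F)) := by
        intro x hx
        by_cases hxY : x ∈ Submodule.span F (Set.range Y)
        · exact Or.inr hxY
        · exact Or.inl ⟨hx, hxY⟩
      have h5 := (pr_mono hν.nonneg h4).trans (pr_union_le hν.nonneg _ _)
      linarith
    calc (pr ν V - u) ^ (r + 1) = (pr ν V - u) ^ r * (pr ν V - u) := pow_succ _ _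
      _ ≤ pr (pw fun _ : Fin r => ν) {Y | (∀ i, Y i ∈ V) ∧ LinearIndependent F Y} *
          (pr ν V - u) := mul_le_mul_of_nonneg_right (ih (by omega)) (by linarith)
      _ = ∑ Y : Fin r → Fin n → F, if (∀ i, Y i ∈ V) ∧ LinearIndependent F Y then
          pw (fun _ : Fin r => ν) Y * (pr ν V - u) else 0 := by
          rw [pr_eq_sum_ite, Finset.sum_mul]
          apply Finset.sum_congr rfl
          intro Y _
          rw [ite_mul, zero_mul]
          simp only [Set.mem_ofPred_eq]
          congr
      _ ≤ _ := by
          rw [h1]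
          apply Finset.sum_le_sum
          intro Y _
          split_ifs with h
          · exact mul_le_mul_of_nonneg_left (h2 Y h.2) (pw_nonneg (fun _ => hν.nonneg) Y)
          · exact le_rfl

/-- Bernoulli's inequality: requiring independence of the samples costs only a factor `2`. -/
lemma half_pow_le_sub_pow {p u : ℝ} (hp : 0 < p) (r : ℕ) (h : 2 * r * u ≤ p) (hup : u ≤ p) :
    p ^ r / 2 ≤ (p - u) ^ r := by
  have h1 := one_add_mul_le_pow (a := -(u / p)) (by
    have : u / p ≤ 1 := (div_le_one hp).2 hup
    linarith) r
  have h2 : r * (u / p) ≤ 1 / 2 := by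
    rw [mul_div_assoc', div_le_iff₀ hp]
    linarith
  have h3 : (p - u) ^ r = p ^ r * (1 + -(u / p)) ^ r := by
    rw [← mul_pow]
    congr 1
    field_simp
    ring
  rw [h3, div_eq_mul_one_div]
  apply mul_le_mul_of_nonneg_left _ (by positivity)
  linarith

variable {κ : Type*} [Fintype κ] [DecidableEq κ]

/-- Swapping `r` of the rows for samples of `ν`. -/
lemma pr_span_eq_mul_le {p : κ → (Fin n → F) → ℝ} (hp : ∀ i, IsWeight (p i))
    {ν : (Fin n → F) → ℝ} (hν : IsWeight ν) (V : Submodule F (Fin n → F)) (r : ℕ) {ε : ℝ}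
    (hε0 : 0 ≤ ε) (hε1 : ε ≤ 1) (hV : ∀ i, pr (p i) V ≤ ε) :
    pr (pw p) {X | Submodule.span F (Set.range X) = V} *
      pr (pw fun _ : Fin r => ν) {Y | (∀ i, Y i ∈ V) ∧ LinearIndependent F Y} ≤
    ε ^ r * ∑ I : Finset κ, pr (pw fun i : (Finset.univ : Finset (Fin r)).disjSum I =>
      Sum.elim (fun _ => ν) p (i : Fin r ⊕ κ)) {Z | Submodule.span F (Set.range Z) = V} := by
  by_cases hdim : Module.finrank F V ≤ Fintype.card κ
  swap
  · have : {X : κ → Fin n → F | Submodule.span F (Set.range X) = V} = ∅ := by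
      ext X
      simp only [Set.mem_ofPred_eq, Set.mem_empty_iff_false, iff_false]
      rintro rfl
      exact hdim (finrank_range_le_card X)
    rw [this]
    have h0 : pr (pw p) ∅ = 0 := by simp [pr_eq_sum_ite]
    rw [h0, zero_mul]
    apply mul_nonneg (by positivity)
    refine Finset.sum_nonneg fun I _ => pr_nonneg (pw_nonneg fun i => ?_) _
    rcases i with ⟨i | i, hi⟩
    · exact hν.nonneg
    · exact (hp i).nonneg
  have hq : ∀ i : Fin r ⊕ κ, IsWeight (Sum.elim (fun _ => ν) p i) := by
    rintro (i | i)
    · exact hν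
    · exact hp i
  rw [mul_comm, ← pr_pw_sum_elim, Finset.mul_sum]
  -- The `r` independent samples are completed to a spanning family of `V` by rows in some `I` with
  -- `#I ≤ dim V - r`. As `dim V` is at most the number of rows, at least `r` rows lie outside `I`;
  -- each must fall in `V`, at cost `ε`.
  let t : Finset (Finset κ) := {I | #I + r ≤ Module.finrank F V}
  let E : Finset κ → Set (Fin r ⊕ κ → Fin n → F) := fun I =>
    {X | (fun i : (Finset.univ : Finset (Fin r)).disjSum I => X i) ∈
        {Z : (Finset.univ : Finset (Fin r)).disjSum I → Fin n → F |
          Submodule.span F (Set.range Z) = V} ∧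
      ∀ i ∉ (Finset.univ : Finset (Fin r)).disjSum I, X i ∈ (V : Set (Fin n → F))}
  have hcover := pr_le_sum_pr (IsWeight.pw hq).nonneg t
    (S := {Z | Z ∘ Sum.inl ∈ {Y : Fin r → Fin n → F | (∀ i, Y i ∈ V) ∧ LinearIndependent F Y} ∧
      Z ∘ Sum.inr ∈ {X : κ → Fin n → F | Submodule.span F (Set.range X) = V}}) E (by
    rintro Z ⟨⟨hYV, hY⟩, hX⟩
    have hX : Submodule.span F (Set.range (Z ∘ Sum.inr)) = V := hX
    obtain ⟨I, hI, hspan⟩ := exists_finset_sup_span_eq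
      (Submodule.span F (Set.range (Z ∘ Sum.inl))) (Z ∘ Sum.inr)
    have hle : Submodule.span F (Set.range (Z ∘ Sum.inl)) ≤ V := by
      rw [Submodule.span_le]
      rintro _ ⟨i, rfl⟩
      exact hYV i
    rw [hX, sup_eq_right.2 hle] at hspan
    rw [hX, sup_eq_right.2 hle, finrank_span_eq_card hY, Fintype.card_fin] at hI
    refine ⟨I, by simpa [t] using hI, ?_, ?_⟩
    · rw [Set.mem_ofPred_eq, ← hspan, ← Submodule.span_union]
      congr 1
      ext y
      constructor
      · rintro ⟨⟨i | i, hi⟩, rfl⟩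
        · exact Or.inl ⟨i, rfl⟩
        · exact Or.inr ⟨i, by simpa using hi, rfl⟩
      · rintro (⟨i, rfl⟩ | ⟨i, hi, rfl⟩)
        · exact ⟨⟨Sum.inl i, by simp⟩, rfl⟩
        · exact ⟨⟨Sum.inr i, by simpa using hi⟩, rfl⟩
    · rintro (i | i) _
      · exact hYV i
      · rw [← hX]
        exact Submodule.subset_span ⟨i, rfl⟩)
  refine hcover.trans ?_
  have hterm : ∀ I ∈ t, pr (pw (Sum.elim (fun _ => ν) p)) (E I) ≤
      ε ^ r * pr (pw fun i : (Finset.univ : Finset (Fin r)).disjSum I =>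
        Sum.elim (fun _ => ν) p (i : Fin r ⊕ κ)) {Z | Submodule.span F (Set.range Z) = V} := by
    intro I hI
    have hI : #I + r ≤ Module.finrank F V := by simpa [t] using hI
    have h1 := pr_pw_split_le hq ((Finset.univ : Finset (Fin r)).disjSum I)
      {Z | Submodule.span F (Set.range Z) = V} (fun _ _ => (V : Set (Fin n → F))) ε (by
        rintro Z _ (i | i) hi
        · simp at hi
        · exact hV i)
    refine h1.trans ?_
    rw [mul_comm]
    apply mul_le_mul_of_nonneg_right
    · apply pow_le_pow_of_le_one hε0 hε1
      rw [Finset.card_compl, Finset.card_disjSum, Fintype.card_sum, Finset.card_univ]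
      omega
    · exact pr_nonneg (pw_nonneg fun i => (hq _).nonneg) _
  refine (Finset.sum_le_sum hterm).trans
    (Finset.sum_le_sum_of_subset_of_nonneg (Finset.subset_univ t) fun I _ _ => ?_)
  exact mul_nonneg (by positivity) (pr_nonneg (pw_nonneg fun i => (hq _).nonneg) _)

/-- The swapping bound for the probability that the row space lies in a given collection. -/
lemma pr_span_mem_le_of_swap {p : κ → (Fin n → F) → ℝ} (hp : ∀ i, IsWeight (p i))
    {ν : (Fin n → F) → ℝ} (hν : IsWeight ν) (r : ℕ) {ε u : ℝ} (hε0 : 0 ≤ ε) (hε1 : ε ≤ 1)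
    (hu : ∀ U : Submodule F (Fin n → F), Module.finrank F U < r → pr ν U ≤ u)
    (𝒱 : Finset (Submodule F (Fin n → F)))
    (hV0 : ∀ V ∈ 𝒱, 0 < pr ν V) (hVu : ∀ V ∈ 𝒱, u ≤ pr ν V ∧ 2 * r * u ≤ pr ν V)
    (hV : ∀ V ∈ 𝒱, ∀ i, pr (p i) V ≤ ε * pr ν V) :
    pr (pw p) {X | Submodule.span F (Set.range X) ∈ 𝒱} ≤ 2 * 2 ^ Fintype.card κ * ε ^ r := by
  have hq : ∀ i : Fin r ⊕ κ, IsWeight (Sum.elim (fun _ => ν) p i) := by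
    rintro (i | i)
    · exact hν
    · exact hp i
  have h1 : ∀ V ∈ 𝒱, pr (pw p) {X | Submodule.span F (Set.range X) = V} ≤
      2 * ε ^ r * ∑ I : Finset κ, pr (pw fun i : (Finset.univ : Finset (Fin r)).disjSum I =>
      Sum.elim (fun _ => ν) p (i : Fin r ⊕ κ)) {Z | Submodule.span F (Set.range Z) = V} := by
    intro V hVm
    have hpos := hV0 V hVm
    have hle1 : pr ν V ≤ 1 := hν.pr_le_one _
    have h2 := pr_span_eq_mul_le hp hν V r (mul_nonneg hε0 hpos.le)
      (mul_le_one₀ hε1 hpos.le hle1) (hV V hVm)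
    have h3 := (half_pow_le_sub_pow hpos r (hVu V hVm).2 (hVu V hVm).1).trans
      (le_pr_linearIndependent hν V r hu (hVu V hVm).1 r le_rfl)
    have h4 := (mul_le_mul_of_nonneg_left h3
      (pr_nonneg (IsWeight.pw hp).nonneg {X | Submodule.span F (Set.range X) = V})).trans h2
    rw [mul_pow] at h4
    -- Both sides carry the factor `pr ν V ^ r`. After it cancels, only the ratio `ε` between the
    -- row and lazy probabilities survives.
    have hpr : 0 < pr ν V ^ r := by positivity
    refine le_of_mul_le_mul_right (le_trans (le_of_eq ?_) (h4.trans (le_of_eq ?_)))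
      (half_pos hpr)
    · rfl
    · ring
  calc pr (pw p) {X | Submodule.span F (Set.range X) ∈ 𝒱}
      ≤ ∑ V ∈ 𝒱, pr (pw p) {X | Submodule.span F (Set.range X) = V} :=
        pr_le_sum_pr (IsWeight.pw hp).nonneg 𝒱 _ fun X hX => ⟨_, hX, rfl⟩
    _ ≤ _ := Finset.sum_le_sum h1
    _ = 2 * ε ^ r * ∑ I : Finset κ, ∑ V ∈ 𝒱,
        pr (pw fun i : (Finset.univ : Finset (Fin r)).disjSum I =>
      Sum.elim (fun _ => ν) p (i : Fin r ⊕ κ)) {Z | Submodule.span F (Set.range Z) = V} := by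
        rw [← Finset.mul_sum, Finset.sum_comm]
    _ ≤ 2 * ε ^ r * ∑ I : Finset κ, 1 := by
        apply mul_le_mul_of_nonneg_left _ (by positivity)
        apply Finset.sum_le_sum
        intro I _
        -- For fixed `I` the hybrid family has just one span, so the sum over `V` costs nothing.
        exact (IsWeight.pw fun i => hq _).sum_pr_fiber_le_one 𝒱 _
    _ = _ := by
        simp only [Finset.sum_const, Finset.card_univ, Fintype.card_finset, nsmul_eq_mul, mul_one]
        push_cast
        ring

end Swap

/-! ### Counting subspaces orthogonal to a vector of small defect. -/

section Count

open Finset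
open scoped Classical

variable {F : Type*} [Field F] [Fintype F] {n : ℕ}

/-- Exponential Markov inequality under the uniform law on vectors. The exponential moment factors
over coordinates, and the rate `5 / α` is what `IsSqNorm.sum_exp_le` needs, as each defect averages
at least `α`. -/
lemma card_rowDefect_le (ψ : AddChar F ℂ) (hψ : ψ 1 ≠ 1) {α : ℝ} (hα : 0 < α)
    {w : Fin n → F → ℝ} (hw : ∀ j, IsWeight (w j)) (hb : ∀ j, WBalanced α (w j)) (t : ℝ) :
    (#{v | rowDefect ψ w v ≤ t} : ℝ)
      ≤ Real.exp (5 / α * t) * (7 / 10) ^ n * (Fintype.card F : ℝ) ^ n := by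
  have h1 : ∑ v, Real.exp (-(5 / α * rowDefect ψ w v)) ≤ (7 / 10 * Fintype.card F) ^ n := by
    have h2 : ∑ v, Real.exp (-(5 / α * rowDefect ψ w v))
        = ∏ j, ∑ x, Real.exp (-(5 / α * defect ψ (w j) x)) := by
      rw [Finset.prod_univ_sum, Fintype.piFinset_univ]
      apply Finset.sum_congr rfl
      intro v _
      rw [rowDefect, Finset.mul_sum, ← Finset.sum_neg_distrib, Real.exp_sum]
    rw [h2]
    have h3 : ∀ j, ∑ x, Real.exp (-(5 / α * defect ψ (w j) x)) ≤ 7 / 10 * Fintype.card F := by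
      intro j
      exact (isSqNorm_defect ψ (hw j).nonneg).sum_exp_le hα (by positivity)
        (by rw [div_mul_cancel₀ _ hα.ne'])
        (le_sum_defect ψ hψ (hw j) (hb j) (AddMonoidHom.id F) ⟨1, one_ne_zero⟩)
    refine (Finset.prod_le_prod (fun j _ => Finset.sum_nonneg fun x _ => (Real.exp_pos _).le)
      fun j _ => h3 j).trans ?_
    simp
  have h4 : (#{v | rowDefect ψ w v ≤ t} : ℝ) * Real.exp (-(5 / α * t))
      ≤ ∑ v, Real.exp (-(5 / α * rowDefect ψ w v)) := by
    rw [← nsmul_eq_mul]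
    refine (Finset.card_nsmul_le_sum _ (fun v => Real.exp (-(5 / α * rowDefect ψ w v))) _ ?_).trans
      (Finset.sum_le_sum_of_subset_of_nonneg (Finset.subset_univ _) fun v _ _ => by positivity)
    intro v hv
    have hv : rowDefect ψ w v ≤ t := by simpa using hv
    rw [Real.exp_le_exp, neg_le_neg_iff]
    exact mul_le_mul_of_nonneg_left hv (by positivity)
  have h5 := h4.trans h1
  rw [Real.exp_neg, ← div_eq_mul_inv, div_le_iff₀ (Real.exp_pos _), mul_pow] at h5
  linarith

-- If `c i0 ≠ 0`, a tuple is recovered from its combination and its entries other than `t i0`.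
omit [Fintype F] in
lemma card_sum_smul_mem_le {W : Type*} [AddCommGroup W] [Module F W] [Fintype W] {d : ℕ}
    (B : Finset W) {c : Fin d → F} (hc : c ≠ 0) :
    #{t : Fin d → W | ∑ i, c i • t i ∈ B} ≤ #B * Fintype.card W ^ (d - 1) := by
  obtain ⟨i0, hi0⟩ := Function.ne_iff.1 hc
  have hi0 : c i0 ≠ 0 := hi0
  calc #{t : Fin d → W | ∑ i, c i • t i ∈ B}
      ≤ #(B ×ˢ (Finset.univ : Finset ({i // i ≠ i0} → W))) := by
        apply Finset.card_le_card_of_injOn (fun t => (∑ i, c i • t i, fun i => t i))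
        · intro t ht
          simpa using ht
        · intro t _ t' _ heq
          simp only [Prod.mk.injEq] at heq
          have hne : ∀ i, i ≠ i0 → t i = t' i := fun i hi => congrFun heq.2 ⟨i, hi⟩
          have h0 : c i0 • t i0 = c i0 • t' i0 := by
            have h1 := heq.1
            rw [← Finset.add_sum_erase _ _ (Finset.mem_univ i0),
              ← Finset.add_sum_erase _ (fun i => c i • t' i) (Finset.mem_univ i0)] at h1
            rw [Finset.sum_congr rfl fun i hi => by rw [hne i (Finset.ne_of_mem_erase hi)]] at h1
            exact add_right_cancel h1
          funext i
          by_cases hi : i = i0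
          · rw [hi]
            exact smul_right_injective W hi0 h0
          · exact hne i hi
    _ = _ := by
        rw [Finset.card_product, Finset.card_univ, Fintype.card_fun]
        simp

/-- There are `∏ (q ^ d - q ^ i)` ordered bases, and each factor is at least `q ^ (d - 1)` because
`q ≥ 2`. -/
lemma pow_le_card_bases (U : Submodule F (Fin n → F)) :
    Fintype.card F ^ ((Module.finrank F U - 1) * Module.finrank F U) ≤
      #{t : Fin (Module.finrank F U) → Fin n → F |
        LinearIndependent F t ∧ Submodule.span F (Set.range t) = U} := by
  set d := Module.finrank F U with hd
  set q := Fintype.card F with hq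
  have hq2 : 2 ≤ q := Fintype.one_lt_card
  have h1 : q ^ ((d - 1) * d) ≤ Nat.card {s : Fin d → U // LinearIndependent F s} := by
    rw [card_linearIndependent le_rfl, pow_mul, ← hd, ← hq]
    calc (q ^ (d - 1)) ^ d = ∏ _i : Fin d, q ^ (d - 1) := by simp
      _ ≤ _ := by
        apply Finset.prod_le_prod'
        intro i _
        have hi : (i : ℕ) ≤ d - 1 := by have := i.2; omega
        have h2 : q ^ (i : ℕ) ≤ q ^ (d - 1) := Nat.pow_le_pow_right (by omega) hi
        have h3 : q ^ d = q ^ (d - 1) * q := by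
          rw [← pow_succ]
          congr 1
          have := i.2
          omega
        have h4 : q ^ (d - 1) * 2 ≤ q ^ (d - 1) * q := Nat.mul_le_mul_left _ hq2
        omega
  refine h1.trans ?_
  rw [Nat.card_eq_fintype_card, ← Finset.card_univ]
  apply Finset.card_le_card_of_injOn (fun s i => ((s.1 i : U) : Fin n → F))
  · rintro ⟨s, hs⟩ _
    have hli : LinearIndependent F (U.subtype ∘ s) := hs.map' U.subtype U.ker_subtype
    simp only [Finset.coe_filter, Finset.mem_univ, true_and, Set.mem_ofPred_eq]
    refine ⟨hli, ?_⟩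
    apply Submodule.eq_of_le_of_finrank_eq
    · rw [Submodule.span_le]
      rintro _ ⟨i, rfl⟩
      exact (s i).2
    · exact (finrank_span_eq_card hli).trans (by rw [Fintype.card_fin, hd])
  · rintro ⟨s, hs⟩ _ ⟨s', hs'⟩ _ heq
    apply Subtype.ext
    funext i
    exact Subtype.ext (congrFun heq i)

/-- The number of subspaces of codimension `d` orthogonal to a nonzero vector of `B`. -/
lemma card_mul_pow_le (B : Finset (Fin n → F)) (d : ℕ) (𝒱 : Finset (Submodule F (Fin n → F)))
    (hd : ∀ V ∈ 𝒱, codim V = d) (hB : ∀ V ∈ 𝒱, ∃ v ∈ orth V, v ≠ 0 ∧ v ∈ B) :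
    #𝒱 * Fintype.card F ^ ((d - 1) * d)
      ≤ Fintype.card F ^ d * (#B * (Fintype.card F ^ n) ^ (d - 1)) := by
  let T : Submodule F (Fin n → F) → Finset (Fin d → Fin n → F) := fun V =>
    {t | LinearIndependent F t ∧ Submodule.span F (Set.range t) = orth V}
  have hT : ∀ V ∈ 𝒱, Fintype.card F ^ ((d - 1) * d) ≤ #(T V) := by
    intro V hV
    have h1 := pow_le_card_bases (orth V)
    rw [finrank_orth, hd V hV] at h1
    exact h1
  have hdisj : (𝒱 : Set (Submodule F (Fin n → F))).PairwiseDisjoint T := by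
    intro V _ V' _ hne
    apply Finset.disjoint_left.2
    intro t ht ht'
    simp only [T, Finset.mem_filter] at ht ht'
    exact hne (orth_injective (ht.2.2.symm.trans ht'.2.2))
  -- Ordered bases of the complements are counted twice: distinct `V` have disjoint sets of bases,
  -- and every such basis has a nontrivial combination lying in `B`.
  have hsub : 𝒱.biUnion T ⊆ ({c | c ≠ 0} : Finset (Fin d → F)).biUnion
      fun c => {t : Fin d → Fin n → F | ∑ i, c i • t i ∈ B} := by
    intro t ht
    rw [Finset.mem_biUnion] at ht
    obtain ⟨V, hV, ht⟩ := ht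
    simp only [T, Finset.mem_filter, Finset.mem_univ, true_and] at ht
    obtain ⟨v, hv, hv0, hvB⟩ := hB V hV
    rw [← ht.2, Submodule.mem_span_range_iff_exists_fun] at hv
    obtain ⟨c, hc⟩ := hv
    rw [Finset.mem_biUnion]
    refine ⟨c, ?_, ?_⟩
    · simp only [Finset.mem_filter, Finset.mem_univ, true_and]
      rintro rfl
      apply hv0
      rw [← hc]
      simp
    · simp only [Finset.mem_filter, Finset.mem_univ, true_and]
      rwa [hc]
  calc #𝒱 * Fintype.card F ^ ((d - 1) * d) ≤ ∑ V ∈ 𝒱, #(T V) := by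
        rw [← smul_eq_mul]
        exact Finset.card_nsmul_le_sum _ _ _ hT
    _ = #(𝒱.biUnion T) := (Finset.card_biUnion hdisj).symm
    _ ≤ _ := Finset.card_le_card hsub
    _ ≤ #({c | c ≠ 0} : Finset (Fin d → F)) * (#B * (Fintype.card F ^ n) ^ (d - 1)) := by
        apply Finset.card_biUnion_le_card_mul
        intro c hc
        have := card_sum_smul_mem_le B (c := c) (by simpa using hc)
        rw [Fintype.card_fun, Fintype.card_fin] at this
        convert this
    _ ≤ _ := by
        apply Nat.mul_le_mul_right
        refine (Finset.card_le_univ _).trans ?_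
        simp

/-- The counting bound for the probability that the row space lies in a given collection. -/
lemma pr_span_mem_le_of_count {κ : Type*} [Fintype κ] [DecidableEq κ] {p : κ → (Fin n → F) → ℝ}
    (hp : ∀ i, IsWeight (p i)) (B : Finset (Fin n → F)) {A Q D : ℝ} (hA : 0 ≤ A) (hQ0 : 0 ≤ Q) (hD : 0 ≤ D)
    (hBA : (#B : ℝ) ≤ A * (Fintype.card F : ℝ) ^ n) (𝒱 : Finset (Submodule F (Fin n → F)))
    (hB : ∀ V ∈ 𝒱, ∃ v ∈ orth V, v ≠ 0 ∧ v ∈ B)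
    (hQ : ∀ V ∈ 𝒱, ((Fintype.card F : ℝ) ^ codim V) ^ 2 ≤ Q)
    (hk : ∀ V ∈ 𝒱, n ≤ codim V + Fintype.card κ)
    (hV : ∀ V ∈ 𝒱, ∀ i, pr (p i) V ≤ D * (1 / (Fintype.card F : ℝ) ^ codim V)) :
    pr (pw p) {X | Submodule.span F (Set.range X) ∈ 𝒱}
      ≤ (n + 1) * (A * Q * D ^ Fintype.card κ) := by
  set k := Fintype.card κ
  set q : ℝ := (Fintype.card F : ℝ) with hqdef
  have hq : 1 ≤ q := by
    rw [hqdef]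
    exact_mod_cast Fintype.card_pos
  have hq0 : 0 < q := by linarith
  have hd1 : ∀ V ∈ 𝒱, 1 ≤ codim V := by
    intro V hV
    obtain ⟨v, hv, hv0, -⟩ := hB V hV
    rw [← finrank_orth]
    by_contra! h
    have h0 : Module.finrank F (orth V) = 0 := by omega
    rw [Submodule.finrank_eq_zero] at h0
    rw [h0, Submodule.mem_bot] at hv
    exact hv0 hv
  have hone : ∀ V ∈ 𝒱, pr (pw p) {X | Submodule.span F (Set.range X) = V}
      ≤ (D * (1 / q ^ codim V)) ^ k := by
    intro V hVm
    calc pr (pw p) {X | Submodule.span F (Set.range X) = V}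
        ≤ pr (pw p) {X | ∀ i, X i ∈ (V : Set (Fin n → F))} := by
          apply pr_mono (IsWeight.pw hp).nonneg
          rintro X rfl i
          exact Submodule.subset_span ⟨i, rfl⟩
      _ = ∏ i, pr (p i) V := pr_pw_box p fun _ => (V : Set (Fin n → F))
      _ ≤ ∏ _i : κ, D * (1 / q ^ codim V) :=
          Finset.prod_le_prod (fun i _ => pr_nonneg (hp i).nonneg _) fun i _ => hV V hVm i
      _ = _ := by simp [k]
  have hlayer : ∀ d ∈ Finset.range (n + 1), ∑ V ∈ 𝒱 with codim V = d,
      pr (pw p) {X | Submodule.span F (Set.range X) = V} ≤ A * Q * D ^ k := by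
    intro d _
    set 𝒲 : Finset (Submodule F (Fin n → F)) := {V ∈ 𝒱 | codim V = d}
    have h𝒲 : ∀ V ∈ 𝒲, V ∈ 𝒱 ∧ codim V = d := by
      intro V hV
      simpa [𝒲] using hV
    rcases 𝒲.eq_empty_or_nonempty with h0 | ⟨V0, hV0⟩
    · rw [h0, Finset.sum_empty]
      positivity
    have hV0' := h𝒲 V0 hV0
    have hd := hd1 V0 hV0'.1
    have hkd := hk V0 hV0'.1
    have hQd := hQ V0 hV0'.1
    rw [hV0'.2] at hd hkd hQd
    have hcount := card_mul_pow_le B d 𝒲 (fun V hV => (h𝒲 V hV).2)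
      fun V hV => hB V (h𝒲 V hV).1
    have hcount' : (#𝒲 : ℝ) * q ^ ((d - 1) * d) ≤ q ^ d * (#B * (q ^ n) ^ (d - 1)) := by
      rw [hqdef]
      exact_mod_cast hcount
    have h1 : (#𝒲 : ℝ) * q ^ ((d - 1) * d) ≤ A * (q ^ d) ^ 2 * q ^ (d * k) * q ^ ((d - 1) * d) := by
      refine hcount'.trans ?_
      calc q ^ d * (#B * (q ^ n) ^ (d - 1)) ≤ q ^ d * (A * q ^ n * (q ^ n) ^ (d - 1)) := by
            gcongr
        _ = A * (q ^ d * (q ^ n * (q ^ n) ^ (d - 1))) := by ring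
        _ = A * q ^ (d + n * d) := by
            rw [mul_pow_sub_one (by omega), ← pow_mul, ← pow_add]
        _ ≤ A * q ^ (2 * d + d * k + (d - 1) * d) := by
            apply mul_le_mul_of_nonneg_left _ hA
            -- Uses `n ≤ d + k`: the number of `V` is then at most `A * q ^ (2 * d) * q ^ (d * k)`,
            -- and `q ^ (d * k)` cancels against the probability that all `k` rows lie in `V`.
            apply pow_le_pow_right₀ hq
            obtain ⟨e, rfl⟩ := Nat.exists_eq_add_of_le hd
            simp only [Nat.add_sub_cancel_left]
            nlinarith
        _ = _ := by
            rw [pow_add, pow_add, mul_comm 2 d, pow_mul]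
            ring
    have h2 : (#𝒲 : ℝ) ≤ A * Q * q ^ (d * k) := by
      refine (le_of_mul_le_mul_right h1 (by positivity)).trans ?_
      gcongr
    calc ∑ V ∈ 𝒲, pr (pw p) {X | Submodule.span F (Set.range X) = V}
        ≤ ∑ V ∈ 𝒲, (D * (1 / q ^ d)) ^ k := by
          apply Finset.sum_le_sum
          intro V hV
          have := hone V (h𝒲 V hV).1
          rwa [(h𝒲 V hV).2] at this
      _ = #𝒲 * (D ^ k * (1 / q ^ (d * k))) := by
          rw [Finset.sum_const, nsmul_eq_mul, mul_pow, div_pow, one_pow, pow_mul]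
      _ ≤ A * Q * q ^ (d * k) * (D ^ k * (1 / q ^ (d * k))) := by gcongr
      _ = _ := by
          have : q ^ (d * k) ≠ 0 := by positivity
          field_simp
  calc pr (pw p) {X | Submodule.span F (Set.range X) ∈ 𝒱}
      ≤ ∑ V ∈ 𝒱, pr (pw p) {X | Submodule.span F (Set.range X) = V} :=
        pr_le_sum_pr (IsWeight.pw hp).nonneg 𝒱 _ fun X hX => ⟨_, hX, rfl⟩
    _ = ∑ d ∈ Finset.range (n + 1), ∑ V ∈ 𝒱 with codim V = d,
        pr (pw p) {X | Submodule.span F (Set.range X) = V} := by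
        rw [Finset.sum_fiberwise_of_maps_to]
        intro V _
        rw [Finset.mem_range]
        have := finrank_add_codim V
        omega
    _ ≤ ∑ d ∈ Finset.range (n + 1), A * Q * D ^ k := Finset.sum_le_sum hlayer
    _ = _ := by
        rw [Finset.sum_const, Finset.card_range, nsmul_eq_mul]
        push_cast
        ring

end Count

/-! ### The three cases assembled. -/

section Combine

open Finset
open scoped Classical

variable {F : Type*} [Field F] {n : ℕ}

variable [Fintype F]

/-- The abstract properties of the maximal nonuniformity of the rows with weights `w`. -/
structure IsNonuniformity (w : Fin n → Fin n → F → ℝ) (R : Submodule F (Fin n → F) → ℝ) : Prop where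
  abs_le : ∀ (V : Submodule F (Fin n → F)) i, |pr (pw (w i)) V - 1 / (Fintype.card F : ℝ) ^ codim V| ≤ R V
  exists_eq : ∀ V : Submodule F (Fin n → F), ∃ i, ∃ x : Fin n → F,
    R V = |pr (pw (w i)) {y | y - x ∈ V} - 1 / (Fintype.card F : ℝ) ^ codim V|

variable (ψ : AddChar F ℂ) {w : Fin n → Fin n → F → ℝ} {R : Submodule F (Fin n → F) → ℝ}
  {α δ ζ : ℝ} {κ : Type*} [Fintype κ] [DecidableEq κ]

/-- The unsaturated case in which the nonuniformity is not small compared to the uniform mass. -/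
lemma pr_unsaturated_le (hψ : ψ 1 ≠ 1) (hα : 0 < α) (hδ0 : 0 < δ) (hδ : δ ≤ 1 / 2) (hn : 1 ≤ n)
    (hw : ∀ i j, IsWeight (w i j)) (hb : ∀ i j, WBalanced α (w i j)) (hR : IsNonuniformity w R)
    (e : κ → Fin n) (m : ℕ) (hm : 1 ≤ m) {ε : ℝ} (hε : ε ≤ 1)
    (hmε : 6 * (1 / (m + 1) + Real.exp (-(α * δ * n / (4 * (3 * m + 1) ^ 2)))) ≤ ε)
    (hζ : ζ ≤ 1 / (4 * (3 * m + 1) ^ 2) / 4)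
    (hnbig : 2 * (n : ℝ) ≤ Real.exp (1 / (4 * (3 * m + 1) ^ 2) * α * n / 4)) :
    pr (pw fun i : κ => pw (w (e i))) {X | ¬ IsSparse δ (Submodule.span F (Set.range X)) ∧
      Real.exp (-(ζ * α * n)) < R (Submodule.span F (Set.range X)) ∧
      1 / (Fintype.card F : ℝ) ^ codim (Submodule.span F (Set.range X))
        < 5 * R (Submodule.span F (Set.range X))}
      ≤ n * (2 * 2 ^ Fintype.card κ * ε ^ ⌊δ * n⌋₊) := by
  have hn0 : (1 : ℝ) ≤ n := by exact_mod_cast hn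
  have hm' : (1 : ℝ) ≤ m := by exact_mod_cast hm
  set β : ℝ := 1 / (4 * (3 * m + 1) ^ 2) with hβ
  have hβ0 : 0 < β := by positivity
  have hβ1 : β ≤ 1 / 2 := by
    rw [hβ]
    apply one_div_le_one_div_of_le (by norm_num)
    nlinarith
  set c : ℝ := 1 / (m + 1) + Real.exp (-(α * δ * n / (4 * (3 * m + 1) ^ 2))) with hc
  have hc0 : 0 < c := by positivity
  have hε0 : 0 ≤ ε := le_trans (by positivity) hmε
  have hc1 : c ≤ 1 := by linarith
  let ν : Fin n → (Fin n → F) → ℝ := fun i => pw fun j => lazy β (w i j)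
  have hlw : ∀ i j, IsWeight (lazy β (w i j)) := fun i j =>
    isWeight_lazy (hw i j) hβ0.le (by linarith)
  have hν : ∀ i, IsWeight (ν i) := fun i => IsWeight.pw (hlw i)
  set r := ⌊δ * n⌋₊ with hr
  have hrle : (r : ℝ) ≤ n / 2 := by
    have h1 : (r : ℝ) ≤ δ * n := Nat.floor_le (by positivity)
    nlinarith
  -- The subspaces are sorted by a row `i` that attains the nonuniformity, and row `i` supplies the
  -- lazy law `ν i`. This accounts for the factor `n` in the bound.
  let 𝒱 : Fin n → Finset (Submodule F (Fin n → F)) := fun i =>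
    (Set.toFinite {V : Submodule F (Fin n → F) | ¬ IsSparse δ V ∧ Real.exp (-(ζ * α * n)) < R V ∧
      1 / (Fintype.card F : ℝ) ^ codim V < 5 * R V ∧ ∃ x : Fin n → F,
      R V = |pr (pw (w i)) {y | y - x ∈ V} - 1 / (Fintype.card F : ℝ) ^ codim V|}).toFinset
  have hR𝒱 : ∀ i, ∀ V ∈ 𝒱 i, ¬ IsSparse δ V ∧ Real.exp (-(ζ * α * n)) < R V ∧
      1 / (Fintype.card F : ℝ) ^ codim V < 5 * R V ∧ R V ≤ c * pr (ν i) V := by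
    intro i V hV
    simp only [𝒱, Set.Finite.mem_toFinset, Set.mem_ofPred_eq] at hV
    obtain ⟨h1, h2, h3, x, hx⟩ := hV
    refine ⟨h1, h2, h3, ?_⟩
    rw [hx]
    exact abs_pr_coset_sub_le_lazy ψ hψ hα hδ0.le (hw i) (hb i) h1 x m hm
  have hlow : ∀ i, ∀ V ∈ 𝒱 i, Real.exp (-(ζ * α * n)) ≤ pr (ν i) V := by
    intro i V hV
    obtain ⟨-, h2, -, h4⟩ := hR𝒱 i V hV
    have : c * pr (ν i) V ≤ pr (ν i) V :=
      mul_le_of_le_one_left (pr_nonneg (hν i).nonneg _) hc1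
    linarith
  -- Bounds the lazy mass of any subspace of dimension below `r ≤ n / 2`. The condition `ζ ≤ β / 4`
  -- keeps it below `pr (ν i) V` by the factor `2 * n` required for swapping.
  set u : ℝ := Real.exp (-(β * α * n / 2)) with hu
  have hu2 : 2 * n * u ≤ Real.exp (-(ζ * α * n)) := by
    calc 2 * n * u ≤ Real.exp (β * α * n / 4) * u :=
          mul_le_mul_of_nonneg_right hnbig (Real.exp_pos _).le
      _ = Real.exp (-(β / 4 * (α * n))) := by
          rw [hu, ← Real.exp_add]
          congr 1
          ring
      _ ≤ _ := by
          rw [Real.exp_le_exp, neg_le_neg_iff, mul_assoc]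
          exact mul_le_mul_of_nonneg_right hζ (by positivity)
  have hu0 : 0 < u := Real.exp_pos _
  have hsmall : ∀ i, ∀ U : Submodule F (Fin n → F), Module.finrank F U < r → pr (ν i) U ≤ u := by
    intro i U hU
    have h1 := pr_subspace_le_pow_codim (hlw i)
      (fun j x => lazy_le (hw i j) (hb i j) hβ0.le hβ1 x) U
    refine h1.trans ?_
    have h2 := finrank_add_codim U
    have h3 : (n : ℝ) / 2 ≤ codim U := by
      have h4 : (n : ℝ) ≤ r + codim U := by
        have : n ≤ r + codim U := by omega
        exact_mod_cast this
      linarith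
    have h5 : 0 ≤ 1 - β * α := by
      have : lazy β (w i ⟨0, hn⟩) 0 ≤ 1 - β * α := lazy_le (hw _ _) (hb _ _) hβ0.le hβ1 0
      exact ((hlw i ⟨0, hn⟩).nonneg 0).trans this
    calc (1 - β * α) ^ codim U ≤ Real.exp (-(β * α)) ^ codim U := by
          apply pow_le_pow_left₀ h5
          have := Real.add_one_le_exp (-(β * α))
          linarith
      _ = Real.exp (-(codim U * (β * α))) := by
          rw [← Real.exp_nat_mul]
          congr 1
          ring
      _ ≤ _ := by
          rw [hu, Real.exp_le_exp, neg_le_neg_iff]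
          have := mul_le_mul_of_nonneg_right h3 (mul_pos hβ0 hα).le
          linarith
  have hswap : ∀ i, pr (pw fun i : κ => pw (w (e i)))
      {X | Submodule.span F (Set.range X) ∈ 𝒱 i} ≤ 2 * 2 ^ Fintype.card κ * ε ^ r := by
    intro i
    apply pr_span_mem_le_of_swap (fun i => IsWeight.pw (hw _)) (hν i) r hε0 hε (hsmall i) (𝒱 i)
    · intro V hV
      exact (Real.exp_pos _).trans_le (hlow i V hV)
    · intro V hV
      have h1 := hlow i V hV
      constructor
      · nlinarith
      · have h2 : 2 * r * u ≤ 2 * n * u := by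
          apply mul_le_mul_of_nonneg_right _ hu0.le
          linarith
        linarith
    · intro V hV i'
      obtain ⟨-, -, h3, h4⟩ := hR𝒱 i V hV
      -- The mass of `V` under a row is at most `q ^ (-d) + R V < 6 * R V`, whence the factor `6` in
      -- `hmε`.
      have h5 := (abs_le.1 (hR.abs_le V (e i'))).2
      have h6 := mul_le_mul_of_nonneg_right hmε (pr_nonneg (hν i).nonneg V)
      linarith
  refine (pr_le_sum_pr (IsWeight.pw fun i => IsWeight.pw (hw _)).nonneg Finset.univ
    (fun i => {X | Submodule.span F (Set.range X) ∈ 𝒱 i}) ?_).trans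
    ((Finset.sum_le_sum fun i _ => hswap i).trans (le_of_eq ?_))
  · rintro X ⟨h1, h2, h3⟩
    obtain ⟨i, x, hx⟩ := hR.exists_eq (Submodule.span F (Set.range X))
    refine ⟨i, Finset.mem_univ i, ?_⟩
    simp only [𝒱, Set.Finite.mem_toFinset, Set.mem_ofPred_eq]
    exact ⟨h1, h2, h3, x, hx⟩
  · simp

/-- The semi-saturated case, in which the row space has about uniform probability. -/
lemma pr_semisaturated_le (hψ : ψ 1 ≠ 1) (hα : 0 < α)
    (hw : ∀ i j, IsWeight (w i j)) (hb : ∀ i j, WBalanced α (w i j)) (hR : IsNonuniformity w R)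
    (e : κ → Fin n) :
    pr (pw fun i : κ => pw (w (e i))) {X |
      Real.exp (-(ζ * α * n)) < R (Submodule.span F (Set.range X)) ∧
      5 * R (Submodule.span F (Set.range X))
        ≤ 1 / (Fintype.card F : ℝ) ^ codim (Submodule.span F (Set.range X))}
      ≤ (n + 1) * (n * (Real.exp (10 * ζ * n) * (7 / 10) ^ n) * Real.exp (2 * (ζ * α * n)) *
        (6 / 5) ^ Fintype.card κ) := by
  set q : ℝ := (Fintype.card F : ℝ) with hqdef
  have hq0 : 0 < q := by
    rw [hqdef]
    exact_mod_cast Fintype.card_pos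
  let B : Finset (Fin n → F) := Finset.univ.biUnion fun i =>
    {v | rowDefect ψ (w i) v ≤ 2 * (ζ * α * n)}
  have hBcard : (#B : ℝ) ≤ n * (Real.exp (10 * ζ * n) * (7 / 10) ^ n) * q ^ n := by
    have h1 : (#B : ℝ) ≤ ∑ i : Fin n, (#{v | rowDefect ψ (w i) v ≤ 2 * (ζ * α * n)} : ℝ) := by
      exact_mod_cast Finset.card_biUnion_le
    refine h1.trans ((Finset.sum_le_sum fun i _ =>
      card_rowDefect_le ψ hψ hα (hw i) (hb i) (2 * (ζ * α * n))).trans (le_of_eq ?_))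
    have h2 : 5 / α * (2 * (ζ * α * n)) = 10 * ζ * n := by
      field_simp
      ring
    rw [h2, Finset.sum_const, Finset.card_univ, Fintype.card_fin, nsmul_eq_mul]
    ring
  let 𝒱 : Finset (Submodule F (Fin n → F)) :=
    (Set.toFinite {V : Submodule F (Fin n → F) | Real.exp (-(ζ * α * n)) < R V ∧
      5 * R V ≤ 1 / q ^ codim V ∧ n ≤ codim V + Fintype.card κ}).toFinset
  have h𝒱 : ∀ V, V ∈ 𝒱 ↔ Real.exp (-(ζ * α * n)) < R V ∧
      5 * R V ≤ 1 / q ^ codim V ∧ n ≤ codim V + Fintype.card κ := by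
    intro V
    simp [𝒱]
  refine le_trans (pr_mono (IsWeight.pw fun i => IsWeight.pw (hw _)).nonneg
    (T := {X | Submodule.span F (Set.range X) ∈ 𝒱}) ?_)
    (pr_span_mem_le_of_count (fun i => IsWeight.pw (hw _)) B (by positivity) (by positivity)
      (by norm_num) hBcard 𝒱 ?_ ?_ ?_ ?_)
  · rintro X ⟨h1, h2⟩
    rw [Set.mem_ofPred_eq, h𝒱]
    refine ⟨h1, h2, ?_⟩
    have h3 := finrank_add_codim (Submodule.span F (Set.range X))
    have h4 : Module.finrank F (Submodule.span F (Set.range X)) ≤ Fintype.card κ :=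
      finrank_range_le_card X
    omega
  · intro V hV
    obtain ⟨h1, -, -⟩ := (h𝒱 V).1 hV
    obtain ⟨i, x, hx⟩ := hR.exists_eq V
    by_contra! hcon
    -- If no nonzero orthogonal vector were in `B`, every frequency would contribute at most `exp
    -- (-ζ α n)`, and so would their average, contradicting `h1`.
    have hbig : ∀ v : orth V, v ≠ 0 → 2 * (ζ * α * n) < rowDefect ψ (w i) v := by
      intro v hv
      by_contra! hle
      apply hcon v v.2 fun h => hv (Subtype.ext h)
      simp only [B, Finset.mem_biUnion, Finset.mem_univ, true_and, Finset.mem_filter]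
      exact ⟨i, hle⟩
    have h2 := abs_pr_coset_sub_le ψ hψ (hw i) V x
    rw [← hx] at h2
    have h3 : ∑ v : orth V with v ≠ 0, Real.exp (-(rowDefect ψ (w i) v / 2))
        ≤ q ^ codim V * Real.exp (-(ζ * α * n)) := by
      calc ∑ v : orth V with v ≠ 0, Real.exp (-(rowDefect ψ (w i) v / 2))
          ≤ ∑ v : orth V with v ≠ 0, Real.exp (-(ζ * α * n)) := by
            apply Finset.sum_le_sum
            intro v hv
            have := hbig v (by simpa using hv)
            rw [Real.exp_le_exp]
            linarith
        _ ≤ ∑ v : orth V, Real.exp (-(ζ * α * n)) :=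
            Finset.sum_le_sum_of_subset_of_nonneg (Finset.subset_univ _)
              fun _ _ _ => (Real.exp_pos _).le
        _ = _ := by
            rw [Finset.sum_const, Finset.card_univ, card_orth, nsmul_eq_mul, hqdef]
            push_cast
            rfl
    have h4 : R V ≤ Real.exp (-(ζ * α * n)) := by
      refine h2.trans ?_
      rw [one_div, inv_mul_le_iff₀ (by positivity)]
      exact h3
    linarith
  · intro V hV
    obtain ⟨h1, h2, -⟩ := (h𝒱 V).1 hV
    have h3 : Real.exp (-(ζ * α * n)) ≤ 1 / q ^ codim V := by
      have := Real.exp_pos (-(ζ * α * n))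
      linarith
    rw [le_div_iff₀ (by positivity), Real.exp_neg, inv_mul_le_iff₀ (Real.exp_pos _), mul_one] at h3
    calc (q ^ codim V) ^ 2 ≤ Real.exp (ζ * α * n) ^ 2 := pow_le_pow_left₀ (by positivity) h3 2
      _ = _ := by
        rw [← Real.exp_nat_mul]
        norm_num
  · intro V hV
    exact ((h𝒱 V).1 hV).2.2
  · intro V hV i
    obtain ⟨-, h2, -⟩ := (h𝒱 V).1 hV
    have h5 := (abs_le.1 (hR.abs_le V (e i))).2
    linarith

/-- The bound for the probability that the row space of the top rows is not saturated. -/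
lemma pr_not_saturated_le (hψ : ψ 1 ≠ 1) (hα : 0 < α) (hδ0 : 0 < δ) (hδ : δ ≤ 1 / 100)
    (hn : 1 ≤ n) {k : ℕ} (hk : k ≤ n) (hk' : 9 / 10 * (n : ℝ) ≤ k)
    (hw : ∀ i j, IsWeight (w i j)) (hb : ∀ i j, WBalanced α (w i j)) (hR : IsNonuniformity w R)
    (m : ℕ) (hm : 1 ≤ m) {ε : ℝ} (hε : ε ≤ 1)
    (hmε : 6 * (1 / (m + 1) + Real.exp (-(α * δ * n / (4 * (3 * m + 1) ^ 2)))) ≤ ε)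
    (hζ : ζ ≤ 1 / (4 * (3 * m + 1) ^ 2) / 4)
    (hnbig : 2 * (n : ℝ) ≤ Real.exp (1 / (4 * (3 * m + 1) ^ 2) * α * n / 4)) :
    pr (pw fun i : Fin k => pw (w (Fin.castLE hk i)))
      {X | ¬ (¬ IsSparse δ (Submodule.span F (Set.range X)) ∧
        R (Submodule.span F (Set.range X)) ≤ Real.exp (-(ζ * α * n)))}
      ≤ (Real.exp (-(n / 10)) + (Real.exp 1 * (n : ℝ) ^ (10 / α)) ^ 2 *
        Real.exp (-(89 / 100 * α * n))) + (n * (2 * 2 ^ k * ε ^ ⌊δ * n⌋₊) +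
        (n + 1) * (n * (Real.exp (10 * ζ * n) * (7 / 10) ^ n) * Real.exp (2 * (ζ * α * n)) *
        (6 / 5) ^ k)) := by
  have h1 := pr_isSparse_le ψ hψ hα hδ hn hk hk' (w := fun i => w (Fin.castLE hk i))
    (fun i => hw _) (fun i => hb _)
  have h2 := pr_unsaturated_le ψ hψ hα hδ0 (by linarith) hn hw hb hR (Fin.castLE hk) m hm hε hmε
    hζ hnbig
  have h3 := pr_semisaturated_le ψ (ζ := ζ) hψ hα hw hb hR (Fin.castLE hk)
  rw [Fintype.card_fin] at h2 h3
  have hp := (IsWeight.pw fun i : Fin k => IsWeight.pw (hw (Fin.castLE hk i))).nonneg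
  refine le_trans ?_ (add_le_add h1 (add_le_add h2 h3))
  refine le_trans ?_ (add_le_add_right (pr_union_le hp _ _) _)
  refine le_trans (pr_mono hp ?_) (pr_union_le hp _ _)
  intro X hX
  rw [Set.mem_ofPred_eq, not_and, not_le] at hX
  by_cases hs : IsSparse δ (Submodule.span F (Set.range X))
  · exact Or.inl hs
  · rcases lt_or_ge (1 / (Fintype.card F : ℝ) ^ codim (Submodule.span F (Set.range X)))
      (5 * R (Submodule.span F (Set.range X))) with h | h
    · exact Or.inr (Or.inl ⟨hs, hX hs, h⟩)
    · exact Or.inr (Or.inr ⟨hX hs, h⟩)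

end Combine

/-! ### Translation from measures to weights. -/

section Measures

open Finset
open scoped Classical

lemma measureReal_eq_pr {Ω : Type*} [Fintype Ω] [MeasurableSpace Ω] [MeasurableSingletonClass Ω]
    (ν : Measure Ω) [IsFiniteMeasure ν] (S : Set Ω) : ν.real S = pr (fun x => ν.real {x}) S := by
  rw [pr, sum_measureReal_singleton]
  congr 1
  ext
  simp

lemma isWeight_measureReal {Ω : Type*} [Fintype Ω] [MeasurableSpace Ω]
    [MeasurableSingletonClass Ω] (ν : Measure Ω) [IsProbabilityMeasure ν] :
    IsWeight fun x => ν.real {x} where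
  nonneg _ := measureReal_nonneg
  sum_eq_one := by
    rw [← pr_univ, ← measureReal_eq_pr]
    exact probReal_univ

lemma pi_real_singleton {ι Ω : Type*} [Fintype ι] [MeasurableSpace Ω]
    (ν : ι → Measure Ω) [∀ i, IsProbabilityMeasure (ν i)] (x : ι → Ω) :
    (Measure.pi ν).real {x} = pw (fun i y => (ν i).real {y}) x := by
  simp only [Measure.real, Measure.pi_singleton, ENNReal.toReal_prod, pw]

variable {F : Type*} [Field F] [Fintype F] [MeasurableSpace F] [MeasurableSingletonClass F] {n : ℕ}
  (μ : Fin n → Fin n → Measure F) [∀ i j, IsProbabilityMeasure (μ i j)]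

omit [Field F] in
lemma rowLaw_real_eq_pr (i : Fin n) (S : Set (Fin n → F)) :
    (rowLaw μ i).real S = pr (pw fun j x => (μ i j).real {x}) S := by
  rw [rowLaw, measureReal_eq_pr]
  congr 1
  funext x
  exact pi_real_singleton _ x

omit [Field F] in
lemma matrixLaw_real_eq_pr (S : Set (Fin n → Fin n → F)) :
    (matrixLaw μ).real S = pr (pw fun i => pw fun j x => (μ i j).real {x}) S := by
  have : ∀ i, IsProbabilityMeasure (rowLaw μ i) := fun i => by
    unfold rowLaw
    infer_instance
  rw [matrixLaw, measureReal_eq_pr]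
  congr 1
  funext X
  rw [pi_real_singleton]
  congr 1
  funext i x
  exact pi_real_singleton _ x

lemma wBalanced_of_isBalanced {α : ℝ} {ν : Measure F} [IsProbabilityMeasure ν]
    (h : IsBalanced α ν) : WBalanced α fun x => ν.real {x} := by
  intro H hH x
  rw [← measureReal_eq_pr]
  exact h H hH x

lemma isNonuniformity_nonuniformity (hn : 1 ≤ n) :
    IsNonuniformity (fun i j x => (μ i j).real {x}) (nonuniformity μ) where
  abs_le V i := by
    have h1 : rowNonuniformity μ i V ≤ nonuniformity μ V :=
      le_ciSup (f := fun i => rowNonuniformity μ i V) (Set.finite_range _).bddAbove i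
    have h2 := le_ciSup (f := fun x : Fin n → F => |(rowLaw μ i).real {y | y - x ∈ V}
      - 1 / (Nat.card F : ℝ) ^ codim V|) (Set.finite_range _).bddAbove 0
    refine le_trans (le_of_eq ?_) (h2.trans h1)
    rw [rowLaw_real_eq_pr, Nat.card_eq_fintype_card]
    simp only [sub_zero]
    rfl
  exists_eq V := by
    have : Nonempty (Fin n) := ⟨⟨0, hn⟩⟩
    obtain ⟨i, hi⟩ := exists_eq_ciSup_of_finite (f := fun i => rowNonuniformity μ i V)
    obtain ⟨x, hx⟩ := exists_eq_ciSup_of_finite (f := fun x : Fin n → F =>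
      |(rowLaw μ i).real {y | y - x ∈ V} - 1 / (Nat.card F : ℝ) ^ codim V|)
    refine ⟨i, x, ?_⟩
    rw [nonuniformity, ← hi, rowNonuniformity, ← hx, rowLaw_real_eq_pr, Nat.card_eq_fintype_card]

/-- Passage to the complementary event, followed by the marginal on the top `k` rows. -/
lemma abs_matrixLaw_sub_one_eq {k : ℕ} (hk : k ≤ n) (δ ζ α : ℝ) :
    |(matrixLaw μ).real {X | IsSaturated δ ζ α μ (topRowSpace hk (Matrix.of X))} - 1|
      = pr (pw fun i : Fin k => pw fun j x => (μ (Fin.castLE hk i) j).real {x})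
        {X | ¬ (¬ IsSparse δ (Submodule.span F (Set.range X)) ∧
          nonuniformity μ (Submodule.span F (Set.range X)) ≤ Real.exp (-(ζ * α * n)))} := by
  have : ∀ i, IsProbabilityMeasure (rowLaw μ i) := fun i => by
    unfold rowLaw
    infer_instance
  have : IsProbabilityMeasure (matrixLaw μ) := by
    unfold matrixLaw
    infer_instance
  have hw : ∀ i, IsWeight (pw fun j x => (μ i j).real {x}) := fun i =>
    IsWeight.pw fun j => isWeight_measureReal (μ i j)
  rw [abs_sub_comm, abs_of_nonneg (sub_nonneg.2 measureReal_le_one), ← probReal_compl_eq_one_sub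
    (Set.toFinite _).measurableSet, matrixLaw_real_eq_pr]
  exact pr_pw_comp hw (Fin.castLE hk) (Fin.castLE_injective hk)
    {X | ¬ (¬ IsSparse δ (Submodule.span F (Set.range X)) ∧
      nonuniformity μ (Submodule.span F (Set.range X)) ≤ Real.exp (-(ζ * α * n)))}

end Measures

/-! ### Choice of constants and the final estimate. -/

section Constants

lemma exists_rpow_mul_exp_le (a : ℝ) {b : ℝ} (hb : 0 < b) :
    ∃ C : ℝ, 0 < C ∧ ∀ n : ℕ, (n : ℝ) ^ a * Real.exp (-(b * n)) ≤ C := by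
  have h := (tendsto_rpow_mul_exp_neg_mul_atTop_nhds_zero a b hb).comp
    tendsto_natCast_atTop_atTop
  obtain ⟨C, hC⟩ := h.bddAbove_range
  refine ⟨max C 1, by positivity, fun n => ?_⟩
  refine le_trans ?_ (le_max_left C 1)
  have := hC ⟨n, rfl⟩
  simpa only [Function.comp, neg_mul] using this

lemma exists_error_bound {δ ζ α : ℝ} (hδ : 0 < δ) (hζ : ζ ≤ 1 / 1000) (hα : 0 < α) :
    ∃ C : ℝ, 0 < C ∧ ∀ n k : ℕ, 1 ≤ n → k ≤ n → α ≤ 1 → ∀ ε : ℝ, 0 ≤ ε → ε ≤ Real.exp (-(4 / δ)) →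
      (Real.exp (-(n / 10)) + (Real.exp 1 * (n : ℝ) ^ (10 / α)) ^ 2 *
        Real.exp (-(89 / 100 * α * n))) + (n * (2 * 2 ^ k * ε ^ ⌊δ * n⌋₊) +
        (n + 1) * (n * (Real.exp (10 * ζ * n) * (7 / 10) ^ n) * Real.exp (2 * (ζ * α * n)) *
        (6 / 5) ^ k)) ≤ C * Real.exp (-(1 / 100 * α * n)) := by
  obtain ⟨C1, hC1, h1⟩ := exists_rpow_mul_exp_le (20 / α) (b := 88 / 100 * α) (by positivity)
  obtain ⟨C2, hC2, h2⟩ := exists_rpow_mul_exp_le 2 (b := 1 / 10) (by norm_num)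
  refine ⟨1 + Real.exp 1 ^ 2 * C1 + 2 * Real.exp (4 / δ) + 2 * C2, by positivity, ?_⟩
  intro n k hn hk hα1 ε hε0 hε
  have hn1 : (1 : ℝ) ≤ n := by exact_mod_cast hn
  have hn0 : (0 : ℝ) < n := by linarith
  have hαn : α * n ≤ n := mul_le_of_le_one_left hn0.le hα1
  set E := Real.exp (-(1 / 100 * α * n)) with hE
  have hE0 : 0 < E := Real.exp_pos _
  have t1 : Real.exp (-(n / 10 : ℝ)) ≤ E := by
    rw [hE, Real.exp_le_exp]
    linarith
  have t2 : (Real.exp 1 * (n : ℝ) ^ (10 / α)) ^ 2 * Real.exp (-(89 / 100 * α * n))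
      ≤ Real.exp 1 ^ 2 * C1 * E := by
    have e1 : ((n : ℝ) ^ (10 / α)) ^ 2 = (n : ℝ) ^ (20 / α) := by
      rw [← Real.rpow_natCast, ← Real.rpow_mul hn0.le]
      congr 1
      push_cast
      ring
    have e2 : Real.exp (-(89 / 100 * α * n)) = Real.exp (-(88 / 100 * α * n)) * E := by
      rw [hE, ← Real.exp_add]
      congr 1
      ring
    rw [mul_pow, e1, e2]
    calc Real.exp 1 ^ 2 * (n : ℝ) ^ (20 / α) * (Real.exp (-(88 / 100 * α * n)) * E)
        = Real.exp 1 ^ 2 * ((n : ℝ) ^ (20 / α) * Real.exp (-(88 / 100 * α * n))) * E := by ring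
      _ ≤ _ := by
        have := h1 n
        gcongr
  -- The size of `ε` makes its power about `exp (-4 n)`, against `n * 2 ^ k ≤ exp (2 n)`. The factor
  -- `exp (4 / δ)` pays for rounding down `δ * n`.
  have t3 : n * (2 * 2 ^ k * ε ^ ⌊δ * n⌋₊) ≤ 2 * Real.exp (4 / δ) * E := by
    have e1 : ε ^ ⌊δ * (n : ℝ)⌋₊ ≤ Real.exp (4 / δ - 4 * n) := by
      calc ε ^ ⌊δ * (n : ℝ)⌋₊ ≤ Real.exp (-(4 / δ)) ^ ⌊δ * (n : ℝ)⌋₊ :=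
            pow_le_pow_left₀ hε0 hε _
        _ = Real.exp (-(4 / δ * ⌊δ * (n : ℝ)⌋₊)) := by
            rw [← Real.exp_nat_mul]
            congr 1
            ring
        _ ≤ _ := by
            rw [Real.exp_le_exp]
            have e2 : δ * n - 1 ≤ ⌊δ * (n : ℝ)⌋₊ := by
              have := Nat.lt_floor_add_one (δ * (n : ℝ))
              linarith
            have e3 := mul_le_mul_of_nonneg_left e2 (show 0 ≤ 4 / δ by positivity)
            have e4 : 4 / δ * (δ * n - 1) = 4 * n - 4 / δ := by
              field_simp
            linarith
    have e2 : (2 : ℝ) ^ k ≤ Real.exp n := by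
      calc (2 : ℝ) ^ k ≤ 2 ^ n := pow_le_pow_right₀ (by norm_num) hk
        _ ≤ Real.exp 1 ^ n := by
            apply pow_le_pow_left₀ (by norm_num)
            have := Real.add_one_le_exp 1
            linarith
        _ = _ := by
            rw [← Real.exp_nat_mul, mul_one]
    have e3 : (n : ℝ) ≤ Real.exp n := by
      have := Real.add_one_le_exp (n : ℝ)
      linarith
    calc n * (2 * 2 ^ k * ε ^ ⌊δ * n⌋₊)
        ≤ Real.exp n * (2 * Real.exp n * Real.exp (4 / δ - 4 * n)) := by gcongr
      _ = 2 * Real.exp (4 / δ) * Real.exp (-(2 * n)) := by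
          have : Real.exp (4 / δ - 4 * n) = Real.exp (4 / δ) * Real.exp (-(4 * n)) := by
            rw [← Real.exp_add, sub_eq_add_neg]
          rw [this]
          have e5 : Real.exp (-(2 * n : ℝ)) = Real.exp n * Real.exp n * Real.exp (-(4 * n)) := by
            rw [← Real.exp_add, ← Real.exp_add]
            congr 1
            ring
          rw [e5]
          ring
      _ ≤ _ := by
          apply mul_le_mul_of_nonneg_left _ (by positivity)
          rw [hE, Real.exp_le_exp]
          linarith
  have t4 : (n + 1) * (n * (Real.exp (10 * ζ * n) * (7 / 10) ^ n) * Real.exp (2 * (ζ * α * n)) *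
        (6 / 5) ^ k) ≤ 2 * C2 * E := by
    -- The product `7/10 * 6/5 = 84/100` leaves room for the loss `exp (12/1000 * n)` from `ζ` and
    -- for the polynomial factor.
    have e1 : (7 / 10 : ℝ) ^ n * (6 / 5) ^ k ≤ Real.exp (-(16 / 100 * n)) := by
      calc (7 / 10 : ℝ) ^ n * (6 / 5) ^ k ≤ (7 / 10) ^ n * (6 / 5) ^ n := by
            gcongr
            norm_num
        _ = (84 / 100) ^ n := by
            rw [← mul_pow]
            norm_num
        _ ≤ Real.exp (-(16 / 100)) ^ n := by
            apply pow_le_pow_left₀ (by norm_num)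
            have := Real.add_one_le_exp (-(16 / 100) : ℝ)
            linarith
        _ = _ := by
            rw [← Real.exp_nat_mul]
            congr 1
            ring
    have e2 : Real.exp (10 * ζ * n) * Real.exp (2 * (ζ * α * n)) ≤ Real.exp (12 / 1000 * n) := by
      rw [← Real.exp_add, Real.exp_le_exp]
      have i1 : ζ * n ≤ 1 / 1000 * n := mul_le_mul_of_nonneg_right hζ hn0.le
      have i2 : ζ * (α * n) ≤ 1 / 1000 * (α * n) := mul_le_mul_of_nonneg_right hζ (by positivity)
      linarith
    have e3 : (n : ℝ) ^ (2 : ℝ) = n * n := by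
      rw [Real.rpow_two, pow_two]
    have e4 := h2 n
    rw [e3] at e4
    calc (n + 1) * (n * (Real.exp (10 * ζ * n) * (7 / 10) ^ n) * Real.exp (2 * (ζ * α * n)) *
        (6 / 5) ^ k)
        = (n + 1) * n * (Real.exp (10 * ζ * n) * Real.exp (2 * (ζ * α * n))) *
          ((7 / 10 : ℝ) ^ n * (6 / 5) ^ k) := by ring
      _ ≤ (n + n) * n * Real.exp (12 / 1000 * n) * Real.exp (-(16 / 100 * n)) := by gcongr
      _ = 2 * (n * n * Real.exp (-(1 / 10 * n))) * Real.exp (-(48 / 1000 * n)) := by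
          have e5 : Real.exp (12 / 1000 * n : ℝ) * Real.exp (-(16 / 100 * n))
              = Real.exp (-(1 / 10 * n)) * Real.exp (-(48 / 1000 * n)) := by
            rw [← Real.exp_add, ← Real.exp_add]
            congr 1
            ring
          rw [mul_assoc, e5]
          ring
      _ ≤ 2 * C2 * E := by
          have : Real.exp (-(48 / 1000 * n : ℝ)) ≤ E := by
            rw [hE, Real.exp_le_exp]
            linarith
          gcongr
  linarith

lemma exists_threshold {a b c : ℝ} (ha : 0 < a) (hb : 0 < b) (hc : 0 < c) :
    ∃ N : ℕ, 1 ≤ N ∧ ∀ n : ℕ, N ≤ n →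
      2 * (n : ℝ) ≤ Real.exp (a * n) ∧ Real.exp (-(b * n)) ≤ c := by
  have h1 : ∀ᶠ n : ℕ in Filter.atTop, (n : ℝ) ^ (1 : ℝ) * Real.exp (-a * n) < 1 / 2 :=
    ((tendsto_rpow_mul_exp_neg_mul_atTop_nhds_zero 1 a ha).comp
      tendsto_natCast_atTop_atTop).eventually (gt_mem_nhds (by norm_num))
  have h2 : ∀ᶠ n : ℕ in Filter.atTop, (n : ℝ) ^ (0 : ℝ) * Real.exp (-b * n) < c :=
    ((tendsto_rpow_mul_exp_neg_mul_atTop_nhds_zero 0 b hb).comp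
      tendsto_natCast_atTop_atTop).eventually (gt_mem_nhds hc)
  obtain ⟨N, hN⟩ := Filter.eventually_atTop.1 (h1.and h2)
  refine ⟨max N 1, le_max_right _ _, fun n hn => ?_⟩
  obtain ⟨i1, i2⟩ := hN n ((le_max_left _ _).trans hn)
  rw [Real.rpow_one, neg_mul, Real.exp_neg, ← div_eq_mul_inv, div_lt_iff₀ (Real.exp_pos _)] at i1
  rw [Real.rpow_zero, one_mul, neg_mul] at i2
  exact ⟨by linarith, i2.le⟩

end Constants

theorem mainTheorem6 :
    ∃ η₀ : ℝ, 0 < η₀ ∧ ∀ η : ℝ, 0 < η → η ≤ η₀ →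
    ∃ δ₀ : ℝ, 0 < δ₀ ∧ ∀ δ : ℝ, 0 < δ → δ ≤ δ₀ →
    ∃ ζ₀ : ℝ, 0 < ζ₀ ∧ ∀ ζ : ℝ, 0 < ζ → ζ ≤ ζ₀ →
    ∃ c : ℝ, 0 < c ∧ ∀ α : ℝ, 0 < α → ∃ C : ℝ, 0 < C ∧
      ∀ (F : Type*) [Field F] [Finite F] [MeasurableSpace F] [MeasurableSingletonClass F]
        (n : ℕ) (μ : Fin n → Fin n → MeasureTheory.Measure F)
        [∀ i j, MeasureTheory.IsProbabilityMeasure (μ i j)],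
        (∀ i j, IsBalanced α (μ i j)) →
        ∀ (k : ℕ) (hk : k ≤ n), (1 - η) * (n : ℝ) ≤ (k : ℝ) →
          |(matrixLaw μ).real
              {X | IsSaturated δ ζ α μ (topRowSpace hk (Matrix.of X))} - 1|
            ≤ C * Real.exp (-(c * α * n)) := by
  refine ⟨1 / 10, by norm_num, fun η _ hη1 => ⟨1 / 100, by norm_num, fun δ hδ0 hδ1 => ?_⟩⟩
  set θ : ℝ := Real.exp (-(4 / δ)) with hθ
  have hθ0 : 0 < θ := Real.exp_pos _
  have hθ1 : θ ≤ 1 := Real.exp_le_one_iff.2 (neg_nonpos.2 (by positivity))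
  -- This makes `6 / (m + 1)` at most `θ / 2`; the other half of `θ` absorbs the exponential term
  -- once `n ≥ N`. Since `m` depends only on `δ`, so does the bound on `ζ`.
  obtain ⟨m, hm⟩ := exists_nat_gt (12 / θ)
  have hm1 : (1 : ℝ) < m := lt_of_le_of_lt (by rw [le_div_iff₀ hθ0]; linarith) hm
  have hm1' : 1 ≤ m := by
    have : 1 < m := by exact_mod_cast hm1
    exact this.le
  set L : ℝ := 4 * (3 * m + 1) ^ 2 with hL
  have hL0 : 0 < L := by positivity
  refine ⟨min (1 / L / 4) (1 / 1000), by positivity, fun ζ _ hζ => ⟨1 / 100, by norm_num,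
    fun α hα => ?_⟩⟩
  obtain ⟨C, hC, hbound⟩ := exists_error_bound hδ0 (hζ.trans (min_le_right _ _)) hα
  obtain ⟨N, hN1, hN⟩ := exists_threshold (a := 1 / L * α / 4) (b := α * δ / L) (c := θ / 12)
    (by positivity) (by positivity) (by positivity)
  -- The second summand makes the bound trivial for `n < N`, including `n = 0`.
  refine ⟨C + Real.exp (1 / 100 * α * N), by positivity, ?_⟩
  intro F _ _ _ _ n μ _ hμ k hk hkη
  have := Fintype.ofFinite F
  rw [abs_matrixLaw_sub_one_eq]
  have hw : ∀ i j, IsWeight fun x => (μ i j).real {x} := fun i j => isWeight_measureReal (μ i j)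
  have hb : ∀ i j, WBalanced α fun x => (μ i j).real {x} := fun i j =>
    wBalanced_of_isBalanced (hμ i j)
  set E := Real.exp (-(1 / 100 * α * n)) with hE
  have hE0 : 0 < E := Real.exp_pos _
  rcases lt_or_ge n N with hnN | hnN
  · refine ((IsWeight.pw fun i => IsWeight.pw (hw (Fin.castLE hk i))).pr_le_one _).trans ?_
    have h1 : 1 ≤ Real.exp (1 / 100 * α * N) * E := by
      rw [hE, ← Real.exp_add]
      apply Real.one_le_exp
      have : (n : ℝ) ≤ N := by exact_mod_cast hnN.le
      nlinarith
    rw [add_mul]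
    nlinarith [mul_pos hC hE0]
  · have hn : 1 ≤ n := hN1.trans hnN
    obtain ⟨hn1, hn2⟩ := hN n hnN
    -- An atom has nonnegative mass, at most `1 - α`; reading this off an entry requires `n ≥ 1`.
    have hα1 : α ≤ 1 := by
      have h0 := (hb ⟨0, hn⟩ ⟨0, hn⟩).apply_le 0
      have h1 : 0 ≤ (μ ⟨0, hn⟩ ⟨0, hn⟩).real {0} := measureReal_nonneg
      linarith
    obtain ⟨ψ, hψ⟩ := (AddChar.exists_apply_ne_zero (a := (1 : F))).2 one_ne_zero
    have hk' : 9 / 10 * (n : ℝ) ≤ k := by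
      have : (0 : ℝ) ≤ n := Nat.cast_nonneg n
      nlinarith
    have hsmall : 6 * (1 / (m + 1) + Real.exp (-(α * δ * n / L))) ≤ θ := by
      have i1 : (1 : ℝ) / (m + 1) ≤ θ / 12 := by
        rw [div_le_iff₀ (by positivity)]
        rw [div_lt_iff₀ hθ0] at hm
        nlinarith
      have i2 : α * δ * n / L = α * δ / L * n := by ring
      rw [i2]
      linarith
    have hmain := pr_not_saturated_le ψ hψ hα hδ0 hδ1 hn hk hk' hw hb
      (isNonuniformity_nonuniformity μ hn) m hm1' hθ1 hsmall (hζ.trans (min_le_left _ _)) (by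
        refine hn1.trans (le_of_eq ?_)
        congr 1
        ring)
    refine hmain.trans ((hbound n k hn hk hα1 θ hθ0.le le_rfl).trans ?_)
    exact mul_le_mul_of_nonneg_right (le_add_of_nonneg_right (Real.exp_pos _).le) hE0.le
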